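/- Let $a>b>c>0$ and $0<h<H<c$, and let $\beta,\gamma>0$ be given by $\beta^2=1-H^2/c^2$, $\gamma^2=1-h^2/c^2$ (so $0<\beta<\gamma<1$). Let $z(x,y)=c\left(1-\frac{x^2}{a^2}-\frac{y^2}{b^2}\right)^{1/2}$ be the hemiellipsoid. Write $(\alpha)_n=\alpha(\alpha+1)\cdots(\alpha+n-1)$, let $$F_2[\alpha;\mu,\nu;\delta,\epsilon;x,y]=\sum_{m,n\ge 0}\frac{(\alpha)_{m+n}(\mu)_m(\nu)_n}{(\delta)_m(\epsilon)_n}\frac{x^m}{m!}\frac{y^n}{n!}$$ be Appell's second function, and let $$F^{(3)}\!\left[\begin{array}{l}-::-;2,3;2:\tfrac12;1;\tfrac12;\\ -::-;4;-:1;2;2,2;\end{array}\ x,y,z\right]=\sum_{m,n\ge 0}\left(\sum_{p\ge 0}\frac{(2)_{n+p}(3)_{n+p}(2)_{m+p}}{(4)_{n+p}}\cdot\frac{(\frac12)_m(1)_n(\frac12)_p}{(1)_m(2)_n(2)_p(2)_p}\,\frac{x^m}{m!}\frac{y^n}{n!}\frac{z^p}{p!}\right)$$ be Srivastava's triple hypergeometric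 series with these parameters, summed over $p$ first. For $t>0$ put $$\Phi(t)=\pi b^2t^2\,F_2\!\left[1;\tfrac12,-\tfrac12;1,2;1-\tfrac{b^2}{a^2},-\tfrac{c^2t^2}{a^2}\right]+\frac{\pi b^2c^2t^6}{6a^2}\,F^{(3)}\!\left[\begin{array}{l}-::-;2,3;2:\tfrac12;1;\tfrac12;\\ -::-;4;-:1;2;2,2;\end{array}\ 1-\tfrac{b^2}{a^2},\,t^2,\,-\tfrac{c^2t^2}{a^2}\right].$$ Then the part of the hemiellipsoid between the planes $z=h$ and $z=H$ projects onto the elliptic annulus $D=\{\beta^2\le x^2/a^2+y^2/b^2\le\gamma^2\}$, the partial derivatives of $z(x,y)$ exist on $D$, $\sqrt{1+z_x^2+z_y^2}$ is integrable over $D$, and the curved surface area of that part is $$\hat S=\iint_D\sqrt{1+z_x^2+z_y^2}\,dx\,dy=\Phi(\gamma)-\Phi(\beta).$$ Here, for $t=\beta$ and $t=\gamma$, the double series $F_2$ converges absolutely; in $F^{(3)}$ every inner series over $p$ converges absolutely, and the resulting double series over $(m,n)$ converges absolutely; and if $c^2t^2<b^2(1-t^2)$, then the triple series over $(m,n,p)$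 converges absolutely. -/

import Mathlib

/-! Hypergeometric series in two and three variables, and areas of graphs. -/

/-- The Pochhammer symbol `(a)_n = a (a + 1) ⋯ (a + n - 1)`. -/
noncomputable def poch (a : ℝ) (n : ℕ) : ℝ := (ascPochhammer ℝ n).eval a

/-- The product `∏_j (a_j)_n` over a list of parameters; an empty list gives `1`. -/
noncomputable def pochList (l : List ℝ) (n : ℕ) : ℝ := (l.map (fun a => poch a n)).prod

/-- The `(m, n)` term of Appell's double series `F₂[a; b, c; d, g; x, y]`. -/
noncomputable def appellF2Term (a b c d g x y : ℝ) (q : ℕ × ℕ) : ℝ :=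
  poch a (q.1 + q.2) * poch b q.1 * poch c q.2 * x ^ q.1 * y ^ q.2 /
    (poch d q.1 * poch g q.2 * (q.1.factorial : ℝ) * (q.2.factorial : ℝ))

/-- Appell's second function `F₂[a; b, c; d, g; x, y]`. -/
noncomputable def appellF2 (a b c d g x y : ℝ) : ℝ :=
  ∑' q : ℕ × ℕ, appellF2Term a b c d g x y q

/-- The parameters of Srivastava's general triple hypergeometric series
`F⁽³⁾[(a) :: (b); (b'); (b'') : (c); (c'); (c''); (e) :: (g); (g'); (g'') : (h); (h'); (h'')]`.
Omitted arrays are empty. -/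
structure SrivastavaParams where
  a : List ℝ := []
  b : List ℝ := []
  b' : List ℝ := []
  b'' : List ℝ := []
  c : List ℝ := []
  c' : List ℝ := []
  c'' : List ℝ := []
  e : List ℝ := []
  g : List ℝ := []
  g' : List ℝ := []
  g'' : List ℝ := []
  h : List ℝ := []
  h' : List ℝ := []
  h'' : List ℝ := []

/-- The coefficient `Λ(m, n, p)`. -/
noncomputable def SrivastavaParams.coeff (P : SrivastavaParams) (m n p : ℕ) : ℝ :=
  (pochList P.a (m + n + p) * pochList P.b (m + n) * pochList P.b' (n + p) *
      pochList P.b'' (m + p)) /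
    (pochList P.e (m + n + p) * pochList P.g (m + n) * pochList P.g' (n + p) *
      pochList P.g'' (m + p)) *
  ((pochList P.c m * pochList P.c' n * pochList P.c'' p) /
    (pochList P.h m * pochList P.h' n * pochList P.h'' p))

/-- The `(m, n, p)` term `Λ(m, n, p) (x^m / m!) (y^n / n!) (z^p / p!)`. -/
noncomputable def srivastavaF3Term (P : SrivastavaParams) (x y z : ℝ) (m n p : ℕ) : ℝ :=
  P.coeff m n p * (x ^ m / (m.factorial : ℝ)) * (y ^ n / (n.factorial : ℝ)) *
    (z ^ p / (p.factorial : ℝ))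

/-- Srivastava's triple series `F⁽³⁾[x, y, z]`, summed over `p` first and then over `(m, n)`.
Whenever the triple series converges absolutely, this is its unordered sum. -/
noncomputable def srivastavaF3 (P : SrivastavaParams) (x y z : ℝ) : ℝ :=
  ∑' q : ℕ × ℕ, ∑' p : ℕ, srivastavaF3Term P x y z q.1 q.2 p

/-- The hemiellipsoid `z = c (1 - x²/a² - y²/b²)^{1/2}`. -/
noncomputable def hemiellipsoid (a b c x y : ℝ) : ℝ :=
  c * Real.sqrt (1 - x ^ 2 / a ^ 2 - y ^ 2 / b ^ 2)

/-- The projection to the `x`-`y` plane of the part of the hemiellipsoid between the planes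
`z = h` and `z = H` (meant for `0 < h`, so that only points under the surface occur). -/
def frustumShadow (a b c h H : ℝ) : Set (ℝ × ℝ) :=
  {q | h ≤ hemiellipsoid a b c q.1 q.2 ∧ hemiellipsoid a b c q.1 q.2 ≤ H}

/-- The area element `sqrt (1 + z_x² + z_y²)` of the graph `z = f(x, y)`. -/
noncomputable def areaElement (f : ℝ → ℝ → ℝ) (q : ℝ × ℝ) : ℝ :=
  Real.sqrt (1 + (deriv (fun x => f x q.2) q.1) ^ 2 + (deriv (fun y => f q.1 y) q.2) ^ 2)

/-- The parameters
`- :: -; 2, 3; 2 : 1/2; 1; 1/2;` over `- :: -; 4; - : 1; 2; 2, 2;`. -/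
noncomputable def frustumParams : SrivastavaParams where
  b' := [2, 3]
  b'' := [2]
  c := [1 / 2]
  c' := [1]
  c'' := [1 / 2]
  g' := [4]
  h := [1]
  h' := [2]
  h'' := [2, 2]

/-- The function `Φ` whose difference gives the area of the frustum. -/
noncomputable def frustumPhi (a b c t : ℝ) : ℝ :=
  Real.pi * b ^ 2 * t ^ 2 *
      appellF2 1 (1 / 2) (-1 / 2) 1 2 (1 - b ^ 2 / a ^ 2) (-(c ^ 2 * t ^ 2 / a ^ 2)) +
    Real.pi * b ^ 2 * c ^ 2 * t ^ 6 / (6 * a ^ 2) *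
      srivastavaF3 frustumParams (1 - b ^ 2 / a ^ 2) (t ^ 2) (-(c ^ 2 * t ^ 2 / a ^ 2))

/-! Put κ = c²/a² and u = 1 - b²/a². The substitution x = a R cos φ, y = (b²/a) R sin φ turns x²/a²
+ y²/b² into R²q with q = 1 - u sin²φ, and the area element into √(1 + κR²/(1 - R²q)). With ρ = R²q
the domain becomes a rectangle and the integrand becomes, up to the factor b²/2, the kernel q⁻¹ √(1
+ κρ/(q(1 - ρ))) (`integral_areaElement_annulus`, `integral_polarArea`). The kernel is integrable
down to ρ = 0, so the area is a difference of integrals over 0 < ρ ≤ t² at t = γ and t = β.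

Write U = u sin²φ, V = ρ, W = κρ. Expanding the kernel in U, V and W is not absolutely convergent on
the whole rectangle in general, so the powers of W are summed first: for fixed (m, j) the
coefficient of U^m V^j is a series in W that converges for W < 1. Two facts make the resulting
double series converge for all U, V in [0, 1). First, (1 + W/(1 - V))^(-α) is holomorphic in the
unit disc, and Cauchy's estimate bounds its coefficients uniformly in W < 1 and α ≥ -1
(`abs_quotCoeff_le`). Secondly, with X = W/(1 - V), the factorization 1 + X/(1 - U) = (1 + X)(1 -
U/(1 + X))/(1 - U) reduces the dependence on U to binomial series (`hasSum_sqrtCoeff_double`). The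
bounds are uniform on the rectangle, so termwise integration is allowed; the powers of sin² supply
the factors (1/2)_m/m!.

The column j = 0 is the kernel with V = 0 inside the root. Its integral is the F₂ term, and it
converges absolutely because u + κt² < 1 (`hasSum_appellF2Term`). The columns j ≥ 1 make up the F⁽³⁾
term (`hasSum_frustumParams_outer`). -/

theorem poch_zero (a : ℝ) : poch a 0 = 1 := by simp [poch]

theorem poch_succ (a : ℝ) (n : ℕ) : poch a (n + 1) = poch a n * (a + n) := by
  simp [poch, ascPochhammer_succ_eval]

theorem poch_add (a : ℝ) (m n : ℕ) : poch a (m + n) = poch a m * poch (a + m) n := by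
  induction n with
  | zero => simp [poch_zero]
  | succ n ih =>
    rw [← add_assoc, poch_succ, ih, poch_succ]
    push_cast
    ring

theorem poch_one (n : ℕ) : poch 1 n = n.factorial := by
  simp [poch, ascPochhammer_eval_one]

theorem poch_nonneg {a : ℝ} (ha : 0 ≤ a) (n : ℕ) : 0 ≤ poch a n := by
  induction n with
  | zero => simp [poch_zero]
  | succ n ih => rw [poch_succ]; positivity

/-! ### Binomial series. -/

/-- The coefficient `(α)_n / n!` of `z ^ n` in `(1 - z) ^ (-α)`. -/
noncomputable def riseCoeff (α : ℝ) (n : ℕ) : ℝ := poch α n / n.factorial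

theorem riseCoeff_eq_multichoose (α : ℝ) (n : ℕ) : riseCoeff α n = Ring.multichoose α n := by
  have h := Ring.factorial_nsmul_multichoose_eq_ascPochhammer α n
  rw [Polynomial.ascPochhammer_smeval_eq_eval, nsmul_eq_mul] at h
  rw [riseCoeff, poch, ← h]
  field_simp

theorem riseCoeff_zero (α : ℝ) : riseCoeff α 0 = 1 := by simp [riseCoeff, poch_zero]

theorem riseCoeff_zero_succ (n : ℕ) : riseCoeff 0 (n + 1) = 0 := by
  rw [riseCoeff_eq_multichoose, Ring.multichoose_zero_succ]

theorem riseCoeff_nonneg {α : ℝ} (hα : 0 ≤ α) (n : ℕ) : 0 ≤ riseCoeff α n :=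
  div_nonneg (poch_nonneg hα n) (by positivity)

theorem riseCoeff_succ (α : ℝ) (n : ℕ) :
    riseCoeff α (n + 1) = riseCoeff α n * ((α + n) / (n + 1)) := by
  simp only [riseCoeff, poch_succ, Nat.factorial_succ]
  push_cast
  field_simp

theorem abs_riseCoeff_le_one {α : ℝ} (h₁ : -1 ≤ α) (h₂ : α ≤ 1) (n : ℕ) :
    |riseCoeff α n| ≤ 1 := by
  induction n with
  | zero => simp [riseCoeff_zero]
  | succ n ih =>
    rw [riseCoeff_succ, abs_mul]
    refine mul_le_one₀ ih (abs_nonneg _) ?_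
    rw [abs_div, abs_of_pos (by positivity : (0 : ℝ) < n + 1), div_le_one (by positivity), abs_le]
    have : (0 : ℝ) ≤ n := n.cast_nonneg
    constructor <;> linarith

theorem riseCoeff_mono {α α' : ℝ} (h₀ : 0 ≤ α) (h : α ≤ α') (n : ℕ) :
    riseCoeff α n ≤ riseCoeff α' n := by
  induction n with
  | zero => simp [riseCoeff_zero]
  | succ n ih =>
    rw [riseCoeff_succ, riseCoeff_succ]
    have := riseCoeff_nonneg (h₀.trans h) n
    gcongr

/-- This is Chu–Vandermonde, transported through `Ring.choose (-z) n = (-1) ^ n * riseCoeff z n`. -/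
theorem riseCoeff_add (x y : ℝ) (m : ℕ) :
    riseCoeff (x + y) m = ∑ p ∈ Finset.HasAntidiagonal.antidiagonal m, riseCoeff x p.1 * riseCoeff y p.2 := by
  have key : ∀ (z : ℝ) (n : ℕ), Ring.choose (-z) n = (-1) ^ n * riseCoeff z n := by
    intro z n
    rw [Ring.choose_neg', riseCoeff_eq_multichoose]
    simp [Units.smul_def, Int.negOnePow_def]
  have h := Ring.add_choose_eq (r := -x) (s := -y) m (mul_comm _ _)
  rw [← neg_add, key] at h
  have h2 : ∑ p ∈ Finset.HasAntidiagonal.antidiagonal m, Ring.choose (-x) p.1 * Ring.choose (-y) p.2 =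
      (-1) ^ m * ∑ p ∈ Finset.HasAntidiagonal.antidiagonal m, riseCoeff x p.1 * riseCoeff y p.2 := by
    rw [Finset.mul_sum]
    refine Finset.sum_congr rfl fun p hp => ?_
    rw [key, key, ← Finset.HasAntidiagonal.mem_antidiagonal.mp hp, pow_add]
    ring
  rw [h2] at h
  exact mul_left_cancel₀ (pow_ne_zero m (by norm_num)) h

/-- Both sides equal (α)_{i+n} / (i! n!). -/
theorem riseCoeff_mul_shift (α : ℝ) (i n : ℕ) :
    riseCoeff α i * riseCoeff (α + i) n = riseCoeff α n * riseCoeff (α + n) i := by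
  have h : poch α i * poch (α + i) n = poch α n * poch (α + n) i := by
    rw [← poch_add, ← poch_add, add_comm]
  simp only [riseCoeff]
  rw [div_mul_div_comm, div_mul_div_comm, h, mul_comm (i.factorial : ℝ)]

/-- Coefficient form of the factorization of 1 + X/(1 - U): split n + 1 = (-1/2 + n) + 3/2, apply
Vandermonde, then move the shift from n to the summation index. -/
theorem riseCoeff_mul_riseCoeff_succ (n m : ℕ) :
    riseCoeff (-1 / 2) n * riseCoeff (n + 1) m =
      ∑ p ∈ Finset.HasAntidiagonal.antidiagonal m,
        riseCoeff (-1 / 2) p.1 * riseCoeff (3 / 2) p.2 * riseCoeff (-1 / 2 + p.1) n := by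
  rw [show (n + 1 : ℝ) = (-1 / 2 + n) + 3 / 2 by ring, riseCoeff_add, Finset.mul_sum]
  refine Finset.sum_congr rfl fun p _ => ?_
  have := riseCoeff_mul_shift (-1 / 2) p.1 n
  linear_combination (-riseCoeff (3 / 2) p.2) * this

theorem hasSum_riseCoeff_cpow (α : ℝ) {z : ℂ} (hz : ‖z‖ < 1) :
    HasSum (fun n => (riseCoeff α n : ℂ) * z ^ n) ((1 - z) ^ (-α : ℂ)) := by
  have h := (Complex.one_div_one_sub_cpow_hasFPowerSeriesOnBall_zero (α : ℂ)).hasSum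
    (y := z) (by simpa [enorm_eq_nnnorm, ← NNReal.coe_lt_coe] using hz)
  simp only [zero_add] at h
  rw [Complex.cpow_neg, ← one_div]
  refine h.congr_fun fun n => ?_
  rw [FormalMultilinearSeries.ofScalars_apply_eq, riseCoeff_eq_multichoose, smul_eq_mul,
    Ring.multichoose_eq, Complex.ofReal_choose]
  push_cast
  rfl

theorem hasSum_riseCoeff (α : ℝ) {x : ℝ} (hx : |x| < 1) :
    HasSum (fun n => riseCoeff α n * x ^ n) ((1 - x) ^ (-α)) := by
  have h := hasSum_riseCoeff_cpow α (z := (x : ℂ)) (by simpa using hx)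
  have h1 : ((1 : ℂ) - x) ^ (-α : ℂ) = (((1 - x) ^ (-α) : ℝ) : ℂ) := by
    rw [Complex.ofReal_cpow (by linarith [le_abs_self x])]
    push_cast
    rfl
  rw [h1] at h
  exact_mod_cast h

theorem summable_abs_riseCoeff (α : ℝ) {x : ℝ} (h₀ : 0 ≤ x) (h₁ : x < 1) :
    Summable fun n => |riseCoeff α n| * x ^ n := by
  have h := (hasSum_riseCoeff α (x := x) (by rwa [abs_of_nonneg h₀])).summable.abs
  refine h.congr fun n => ?_
  rw [abs_mul, abs_of_nonneg (pow_nonneg h₀ n)]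

theorem hasSum_riseCoeff_natCast (n : ℕ) {z : ℂ} (hz : ‖z‖ < 1) :
    HasSum (fun j => (riseCoeff n j : ℂ) * z ^ j) (((1 - z) ^ n)⁻¹) := by
  have h := hasSum_riseCoeff_cpow n hz
  rwa [Complex.cpow_neg, Complex.ofReal_natCast, Complex.cpow_natCast] at h

theorem hasSum_riseCoeff_natCast_real (n : ℕ) {x : ℝ} (hx : |x| < 1) :
    HasSum (fun j => riseCoeff n j * x ^ j) (((1 - x) ^ n)⁻¹) := by
  have h := hasSum_riseCoeff n hx
  rwa [Real.rpow_neg (by linarith [le_abs_self x]), Real.rpow_natCast] at h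

/-! ### Power series of (1 + W/(1 - V))^(-α) in the unit disc. -/

/-- The coefficient of `V ^ j` in `(1 + W / (1 - V)) ^ (-α)`, as a power series in `W`. -/
noncomputable def quotCoeff (α W : ℝ) (j : ℕ) : ℝ :=
  ∑' n : ℕ, riseCoeff α n * (-W) ^ n * riseCoeff n j

/-- Summing over the second index first gives (1 - v)^(-n), which leaves a binomial series at W/(1 -
v) < 1. -/
theorem summable_quotCoeff_double (α : ℝ) {W v : ℝ} (hW : 0 ≤ W) (hv : 0 ≤ v) (hWv : W < 1 - v) :
    Summable fun q : ℕ × ℕ => |riseCoeff α q.1| * W ^ q.1 * (riseCoeff q.1 q.2 * v ^ q.2) := by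
  have hv1 : v < 1 := by linarith
  have inner : ∀ n : ℕ, HasSum (fun j : ℕ => |riseCoeff α n| * W ^ n * (riseCoeff n j * v ^ j))
      (|riseCoeff α n| * (W / (1 - v)) ^ n) := by
    intro n
    have h := (hasSum_riseCoeff_natCast_real n (x := v)
      (by rwa [abs_of_nonneg hv])).mul_left (|riseCoeff α n| * W ^ n)
    rwa [mul_assoc (|riseCoeff α n|), ← div_eq_mul_inv, ← div_pow] at h
  refine (summable_prod_of_nonneg fun q => ?_).mpr ⟨fun n => (inner n).summable, ?_⟩
  · have := riseCoeff_nonneg (Nat.cast_nonneg (α := ℝ) q.1) q.2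
    simp only [Pi.zero_apply]
    positivity
  · simp only [(inner _).tsum_eq]
    exact summable_abs_riseCoeff α (div_nonneg hW (by linarith))
      ((div_lt_one (by linarith)).mpr hWv)

theorem summable_quotCoeff (α : ℝ) {W : ℝ} (h₀ : 0 ≤ W) (h₁ : W < 1) (j : ℕ) :
    Summable fun n : ℕ => riseCoeff α n * (-W) ^ n * riseCoeff n j := by
  obtain ⟨v, hv0, hv1⟩ := exists_between (show (0 : ℝ) < 1 - W by linarith)
  have h := (summable_quotCoeff_double α h₀ hv0.le (by linarith : W < 1 - v)).prod_symm.prod_factor j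
  have h2 := h.mul_right ((v ^ j)⁻¹)
  refine Summable.of_abs (h2.congr fun n => ?_)
  have := riseCoeff_nonneg (Nat.cast_nonneg (α := ℝ) n) j
  simp only [Prod.swap]
  rw [abs_mul, abs_mul, abs_pow, abs_neg, abs_of_nonneg h₀, abs_of_nonneg this]
  field_simp

/-- In this smaller disc the double series converges absolutely, so it may be summed by rows, giving
the function, or by columns, giving the coefficients. -/
theorem hasSum_quotCoeff_of_small (α : ℝ) {W : ℝ} (h₀ : 0 ≤ W) {V : ℂ}
    (hV : ‖V‖ < 1 - W) :
    HasSum (fun j => (quotCoeff α W j : ℂ) * V ^ j) ((1 + W / (1 - V)) ^ (-α : ℂ)) := by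
  have hV1 : ‖V‖ < 1 := by linarith
  have h1V : 1 - ‖V‖ ≤ ‖1 - V‖ := by
    have := norm_sub_norm_le (1 : ℂ) V
    simpa using this
  have hne : (1 - V) ≠ 0 := fun h => by
    rw [h, norm_zero] at h1V
    linarith
  have hS : Summable fun q : ℕ × ℕ =>
      (riseCoeff α q.1 : ℂ) * (-W : ℂ) ^ q.1 * ((riseCoeff q.1 q.2 : ℂ) * V ^ q.2) := by
    refine Summable.of_norm ((summable_quotCoeff_double α h₀ (norm_nonneg V)
      (by linarith : W < 1 - ‖V‖)).congr fun q => ?_)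
    have := riseCoeff_nonneg (Nat.cast_nonneg (α := ℝ) q.1) q.2
    simp [abs_of_nonneg h₀, abs_of_nonneg this]
  have hq : ‖-(W : ℂ) / (1 - V)‖ < 1 := by
    rw [norm_div, norm_neg, Complex.norm_real, Real.norm_of_nonneg h₀,
      div_lt_one (norm_pos_iff.mpr hne)]
    linarith
  have hrow := hS.hasSum.prod_fiberwise (fun n =>
    (hasSum_riseCoeff_natCast n hV1).mul_left ((riseCoeff α n : ℂ) * (-W : ℂ) ^ n))
  have hval := hasSum_riseCoeff_cpow α hq
  have hcol := hS.prod_symm.hasSum.prod_fiberwise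
    (g := fun j => (quotCoeff α W j : ℂ) * V ^ j) (fun j => by
      have h := (summable_quotCoeff α h₀ (by linarith [norm_nonneg V]) j).hasSum
      have h2 := ((Complex.hasSum_ofReal (f := fun n : ℕ =>
        riseCoeff α n * (-W) ^ n * riseCoeff n j)).mpr h).mul_right (V ^ j)
      refine h2.congr_fun fun n => ?_
      simp only [Prod.swap]
      push_cast
      ring)
  have e1 : ∑' q : ℕ × ℕ,
      (riseCoeff α q.1 : ℂ) * (-W : ℂ) ^ q.1 * ((riseCoeff q.1 q.2 : ℂ) * V ^ q.2) =
      (1 + W / (1 - V)) ^ (-α : ℂ) := by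
    rw [show (1 : ℂ) + W / (1 - V) = 1 - -(W : ℂ) / (1 - V) by ring]
    refine hrow.unique (hval.congr_fun fun n => ?_)
    rw [div_pow, div_eq_mul_inv, mul_assoc]
  have e2 := (Equiv.prodComm ℕ ℕ).tsum_eq (fun q : ℕ × ℕ =>
      (riseCoeff α q.1 : ℂ) * (-W : ℂ) ^ q.1 * ((riseCoeff q.1 q.2 : ℂ) * V ^ q.2))
  rw [← e1, ← e2]
  exact hcol

theorem iteratedDeriv_eq_of_hasSum {f : ℂ → ℂ} {a : ℕ → ℂ} {δ : ℝ} (hδ : 0 < δ)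
    (h : ∀ z : ℂ, ‖z‖ < δ → HasSum (fun n => a n * z ^ n) (f z)) (n : ℕ) :
    iteratedDeriv n f 0 = n.factorial * a n := by
  obtain ⟨r, hr0, hr1⟩ := exists_between hδ
  lift r to NNReal using hr0.le
  have hp : HasFPowerSeriesOnBall f (FormalMultilinearSeries.ofScalars ℂ a) 0 r :=
    { r_le := by
        have hs := (h r (by simpa using hr1)).summable.norm
        refine FormalMultilinearSeries.le_radius_of_summable _ (hs.congr fun n => ?_)
        rw [FormalMultilinearSeries.ofScalars_norm]
        simp
      r_pos := by exact_mod_cast hr0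
      hasSum := by
        intro y hy
        have hy' : ‖y‖ < r := by
          simpa [enorm_eq_nnnorm, ← NNReal.coe_lt_coe] using hy
        rw [zero_add]
        refine (h y (hy'.trans hr1)).congr_fun fun n => ?_
        rw [FormalMultilinearSeries.ofScalars_apply_eq, smul_eq_mul] }
  have hat := hp.hasFPowerSeriesAt
  have heq := hat.eq_formalMultilinearSeries hat.analyticAt.hasFPowerSeriesAt
  have := congrFun (FormalMultilinearSeries.ofScalars_series_injective ℂ ℂ heq) n
  rw [this, mul_div_cancel₀]
  exact_mod_cast n.factorial_ne_zero

/-- 1/(1 - V) has nonnegative real part. Hence the base stays off the branch cut and has modulus at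
least 1. -/
theorem one_le_re_one_add_div {W : ℝ} (h₀ : 0 ≤ W) {V : ℂ} (hV : ‖V‖ < 1) :
    1 ≤ (1 + W / (1 - V)).re := by
  have hre : 0 ≤ (1 - V).re := by
    have := (Complex.re_le_norm V)
    simp only [Complex.sub_re, Complex.one_re]
    linarith
  rw [Complex.add_re, Complex.one_re, div_eq_mul_inv, Complex.re_ofReal_mul, Complex.inv_re]
  have : 0 ≤ W * ((1 - V).re / Complex.normSq (1 - V)) :=
    mul_nonneg h₀ (div_nonneg hre (Complex.normSq_nonneg _))
  linarith

theorem differentiableOn_one_add_div_cpow (α : ℝ) {W : ℝ} (h₀ : 0 ≤ W) :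
    DifferentiableOn ℂ (fun V : ℂ => (1 + W / (1 - V)) ^ (-α : ℂ)) (Metric.ball 0 1) := by
  intro V hV
  have hV1 : ‖V‖ < 1 := by simpa using hV
  have hne : (1 - V) ≠ 0 := fun h => by
    rw [← sub_eq_zero.mp h, norm_one] at hV1
    exact lt_irrefl _ hV1
  have hs : (1 + W / (1 - V)) ∈ Complex.slitPlane :=
    Or.inl (by linarith [one_le_re_one_add_div h₀ hV1])
  refine DifferentiableAt.differentiableWithinAt (DifferentiableAt.cpow ?_ (by fun_prop) hs)
  exact (differentiableAt_const _).add ((differentiableAt_const _).div (by fun_prop) hne)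

theorem quotCoeff_eq_iteratedDeriv (α : ℝ) {W : ℝ} (h₀ : 0 ≤ W) (h₁ : W < 1) (j : ℕ) :
    iteratedDeriv j (fun V : ℂ => (1 + W / (1 - V)) ^ (-α : ℂ)) 0 =
      j.factorial * (quotCoeff α W j : ℂ) :=
  iteratedDeriv_eq_of_hasSum (sub_pos.mpr h₁) (fun _ hz => hasSum_quotCoeff_of_small α h₀ hz) j

/-- The expansion near 0 identifies the Taylor coefficients; holomorphy then carries the expansion
to the whole disc, beyond the range V < 1 - W of absolute convergence. -/
theorem hasSum_quotCoeff (α : ℝ) {W V : ℝ} (h₀ : 0 ≤ W) (h₁ : W < 1) (hV₀ : 0 ≤ V) (hV₁ : V < 1) :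
    HasSum (fun j => quotCoeff α W j * V ^ j) ((1 + W / (1 - V)) ^ (-α)) := by
  have hV : (V : ℂ) ∈ Metric.ball (0 : ℂ) 1 := by simpa [abs_of_nonneg hV₀] using hV₁
  have h := Complex.hasSum_taylorSeries_on_ball (differentiableOn_one_add_div_cpow α h₀) hV
  have hpos : 0 ≤ 1 + W / (1 - V) := by
    have : 0 ≤ W / (1 - V) := div_nonneg h₀ (by linarith)
    linarith
  have h1 : (1 + (W : ℂ) / (1 - V)) ^ (-α : ℂ) = (((1 + W / (1 - V)) ^ (-α) : ℝ) : ℂ) := by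
    rw [Complex.ofReal_cpow hpos]
    push_cast
    rfl
  simp only [h1] at h
  refine (Complex.hasSum_ofReal (f := fun j => quotCoeff α W j * V ^ j)).mp
    (h.congr_fun fun n => ?_)
  rw [quotCoeff_eq_iteratedDeriv α h₀ h₁]
  have : (n.factorial : ℂ) ≠ 0 := by exact_mod_cast n.factorial_ne_zero
  simp only [sub_zero, smul_eq_mul]
  push_cast
  field_simp

/-- Cauchy's estimate on the circle of radius r. The bound does not depend on α, which matters
because it is used at α = -1/2 + i for every i. -/
theorem abs_quotCoeff_le {α W r : ℝ} (hα : -1 ≤ α) (h₀ : 0 ≤ W) (h₁ : W < 1) (hr₀ : 0 < r)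
    (hr₁ : r < 1) (j : ℕ) : |quotCoeff α W j| ≤ (1 + 1 / (1 - r)) / r ^ j := by
  have hC : ∀ z ∈ Metric.sphere (0 : ℂ) r, ‖(1 + W / (1 - z)) ^ (-α : ℂ)‖ ≤ 1 + 1 / (1 - r) := by
    intro z hz
    have hz' : ‖z‖ = r := by simpa using hz
    have hre := one_le_re_one_add_div h₀ (hz'.trans_lt hr₁)
    have hnorm : 1 ≤ ‖1 + W / (1 - z)‖ := hre.trans (Complex.re_le_norm _)
    rw [show (-α : ℂ) = ((-α : ℝ) : ℂ) by push_cast; rfl, Complex.norm_cpow_real]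
    -- The modulus is at least 1 and -α ≤ 1, so the exponent can be raised to 1.
    calc ‖1 + W / (1 - z)‖ ^ (-α) ≤ ‖1 + W / (1 - z)‖ ^ (1 : ℝ) :=
          Real.rpow_le_rpow_of_exponent_le hnorm (by linarith)
      _ = ‖1 + W / (1 - z)‖ := Real.rpow_one _
      _ ≤ ‖(1 : ℂ)‖ + ‖(W : ℂ) / (1 - z)‖ := norm_add_le _ _
      _ ≤ 1 + 1 / (1 - r) := by
          have h1z : 1 - r ≤ ‖1 - z‖ := by
            have := norm_sub_norm_le (1 : ℂ) z
            simpa [hz'] using this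
          rw [norm_one, norm_div, Complex.norm_real, Real.norm_of_nonneg h₀]
          have : 0 < 1 - r := by linarith
          gcongr
  have hd : DiffContOnCl ℂ (fun V : ℂ => (1 + W / (1 - V)) ^ (-α : ℂ)) (Metric.ball 0 r) :=
    ((differentiableOn_one_add_div_cpow α h₀).mono (fun z hz => by
      have := Metric.closure_ball_subset_closedBall hz
      simp only [Metric.mem_closedBall, dist_zero_right, Metric.mem_ball] at this ⊢
      linarith)).diffContOnCl
  have h := Complex.norm_iteratedDeriv_le_of_forall_mem_sphere_norm_le j hr₀ hd hC
  rw [quotCoeff_eq_iteratedDeriv α h₀ h₁, norm_mul, Complex.norm_natCast, Complex.norm_real,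
    mul_div_assoc] at h
  exact le_of_mul_le_mul_left h (by positivity)

/-! ### The double power series of the kernel in U and V. -/

/-- The coefficient of `U ^ m * V ^ j` in `(1 - U)⁻¹ * √(1 + W / ((1 - U) * (1 - V)))`, as a
power series in `W`. -/
noncomputable def sqrtCoeff (W : ℝ) (m j : ℕ) : ℝ :=
  ∑' n : ℕ, riseCoeff (-1 / 2) n * (-W) ^ n * riseCoeff (n + 1) m * riseCoeff n j

theorem hasSum_sqrtCoeff_aux {W : ℝ} (h₀ : 0 ≤ W) (h₁ : W < 1) (m j : ℕ) :
    HasSum (fun n : ℕ => riseCoeff (-1 / 2) n * (-W) ^ n * riseCoeff (n + 1) m * riseCoeff n j)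
      (∑ p ∈ Finset.HasAntidiagonal.antidiagonal m,
        riseCoeff (-1 / 2) p.1 * riseCoeff (3 / 2) p.2 * quotCoeff (-1 / 2 + p.1) W j) := by
  have h := hasSum_sum (s := Finset.HasAntidiagonal.antidiagonal m) (fun p _ =>
    ((summable_quotCoeff (-1 / 2 + p.1) h₀ h₁ j).hasSum).mul_left
      (riseCoeff (-1 / 2) p.1 * riseCoeff (3 / 2) p.2))
  refine h.congr_fun fun n => ?_
  have := riseCoeff_mul_riseCoeff_succ n m
  calc riseCoeff (-1 / 2) n * (-W) ^ n * riseCoeff (n + 1) m * riseCoeff n j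
      = (riseCoeff (-1 / 2) n * riseCoeff (n + 1) m) * ((-W) ^ n * riseCoeff n j) := by ring
    _ = _ := by
      rw [this, Finset.sum_mul]
      exact Finset.sum_congr rfl fun p _ => by ring

theorem hasSum_sqrtCoeff {W : ℝ} (h₀ : 0 ≤ W) (h₁ : W < 1) (m j : ℕ) :
    HasSum (fun n : ℕ => riseCoeff (-1 / 2) n * (-W) ^ n * riseCoeff (n + 1) m * riseCoeff n j)
      (sqrtCoeff W m j) :=
  (hasSum_sqrtCoeff_aux h₀ h₁ m j).summable.hasSum

theorem sqrtCoeff_eq_sum {W : ℝ} (h₀ : 0 ≤ W) (h₁ : W < 1) (m j : ℕ) :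
    sqrtCoeff W m j = ∑ p ∈ Finset.HasAntidiagonal.antidiagonal m,
      riseCoeff (-1 / 2) p.1 * riseCoeff (3 / 2) p.2 * quotCoeff (-1 / 2 + p.1) W j :=
  (hasSum_sqrtCoeff_aux h₀ h₁ m j).tsum_eq

/-- The coefficients of a majorant of `(1 - U) ^ (1/2) * (1 - U) ^ (-3/2)`. -/
noncomputable def majorCoeff (m : ℕ) : ℝ :=
  ∑ p ∈ Finset.HasAntidiagonal.antidiagonal m, |riseCoeff (-1 / 2) p.1| * |riseCoeff (3 / 2) p.2|

theorem majorCoeff_nonneg (m : ℕ) : 0 ≤ majorCoeff m :=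
  Finset.sum_nonneg fun _ _ => by positivity

theorem summable_majorCoeff {u : ℝ} (h₀ : 0 ≤ u) (h₁ : u < 1) :
    Summable fun m => majorCoeff m * u ^ m := by
  have h := summable_norm_sum_mul_antidiagonal_of_summable_norm
    (summable_abs_riseCoeff (-1 / 2) h₀ h₁).norm (summable_abs_riseCoeff (3 / 2) h₀ h₁).norm
  refine h.of_norm.congr fun m => ?_
  rw [majorCoeff, Finset.sum_mul]
  refine Finset.sum_congr rfl fun p hp => ?_
  rw [← Finset.HasAntidiagonal.mem_antidiagonal.mp hp, pow_add]
  ring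

theorem abs_sqrtCoeff_le {W r : ℝ} (h₀ : 0 ≤ W) (h₁ : W < 1) (hr₀ : 0 < r) (hr₁ : r < 1)
    (m j : ℕ) : |sqrtCoeff W m j| ≤ majorCoeff m * ((1 + 1 / (1 - r)) / r ^ j) := by
  rw [sqrtCoeff_eq_sum h₀ h₁, majorCoeff, Finset.sum_mul]
  refine (Finset.abs_sum_le_sum_abs _ _).trans (Finset.sum_le_sum fun p _ => ?_)
  rw [abs_mul, abs_mul]
  have : (0 : ℝ) ≤ p.1 := p.1.cast_nonneg
  gcongr
  exact abs_quotCoeff_le (by linarith) h₀ h₁ hr₀ hr₁ j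

theorem summable_majorant {u v r : ℝ} (hu₀ : 0 ≤ u) (hu₁ : u < 1) (hv₀ : 0 ≤ v) (hvr : v < r)
    (hr₁ : r < 1) : Summable fun q : ℕ × ℕ =>
      majorCoeff q.1 * ((1 + 1 / (1 - r)) / r ^ q.2) * (u ^ q.1 * v ^ q.2) := by
  have hr₀ : 0 < r := hv₀.trans_lt hvr
  have h1 := summable_majorCoeff hu₀ hu₁
  have h2 := (summable_geometric_of_lt_one (div_nonneg hv₀ hr₀.le)
    ((div_lt_one hr₀).mpr hvr)).mul_left (1 + 1 / (1 - r))
  have hr' : 0 < 1 - r := by linarith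
  have h := h1.mul_of_nonneg h2 (fun m => mul_nonneg (majorCoeff_nonneg m) (by positivity))
    (fun j => by simp only [Pi.zero_apply]; positivity)
  refine h.congr fun q => ?_
  rw [div_pow]
  field_simp

/-- Absolute summability comes from the Cauchy majorant. Summing over j for fixed m restores the
powers (1 + X)^(1/2 - i); what remains is the Cauchy product of the series of (1 - U/(1 + X))^(1/2)
and (1 - U)^(-3/2). -/
theorem hasSum_sqrtCoeff_double {W U V : ℝ} (h₀ : 0 ≤ W) (h₁ : W < 1) (hU₀ : 0 ≤ U) (hU₁ : U < 1)
    (hV₀ : 0 ≤ V) (hV₁ : V < 1) :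
    HasSum (fun q : ℕ × ℕ => sqrtCoeff W q.1 q.2 * (U ^ q.1 * V ^ q.2))
      ((1 - U)⁻¹ * √(1 + W / ((1 - U) * (1 - V)))) := by
  obtain ⟨r, hVr, hr₁⟩ := exists_between hV₁
  have hr₀ : 0 < r := hV₀.trans_lt hVr
  have hS : Summable fun q : ℕ × ℕ => sqrtCoeff W q.1 q.2 * (U ^ q.1 * V ^ q.2) := by
    refine Summable.of_norm_bounded (summable_majorant hU₀ hU₁ hV₀ hVr hr₁) fun q => ?_
    rw [Real.norm_eq_abs, abs_mul, abs_of_nonneg (by positivity : 0 ≤ U ^ q.1 * V ^ q.2)]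
    exact mul_le_mul_of_nonneg_right (abs_sqrtCoeff_le h₀ h₁ hr₀ hr₁ _ _) (by positivity)
  have hX0 : 0 ≤ W / (1 - V) := div_nonneg h₀ (by linarith)
  set X := W / (1 - V) with hX
  have hY : |U / (1 + X)| < 1 := by
    rw [abs_of_nonneg (div_nonneg hU₀ (by linarith)), div_lt_one (by linarith)]
    linarith
  have hrow := hS.hasSum.prod_fiberwise
    (g := fun m => ∑ p ∈ Finset.HasAntidiagonal.antidiagonal m,
      (riseCoeff (-1 / 2) p.1 * (U / (1 + X)) ^ p.1) * (riseCoeff (3 / 2) p.2 * U ^ p.2) *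
        √(1 + X)) (fun m => by
    have h := hasSum_sum (s := Finset.HasAntidiagonal.antidiagonal m) (fun p _ =>
      ((hasSum_quotCoeff (-1 / 2 + p.1) h₀ h₁ hV₀ hV₁)).mul_left
        (riseCoeff (-1 / 2) p.1 * riseCoeff (3 / 2) p.2 * U ^ m))
    have h2 : HasSum (fun j => sqrtCoeff W m j * (U ^ m * V ^ j)) _ := h.congr_fun fun j => by
      rw [sqrtCoeff_eq_sum h₀ h₁, Finset.sum_mul]
      exact Finset.sum_congr rfl fun p _ => by ring
    convert h2 using 1
    refine Finset.sum_congr rfl fun p hp => ?_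
    rw [← Finset.HasAntidiagonal.mem_antidiagonal.mp hp, pow_add, ← hX,
      show -(-1 / 2 + (p.1 : ℝ)) = 1 / 2 - p.1 by ring, Real.rpow_sub (by linarith),
      Real.rpow_natCast, ← Real.sqrt_eq_rpow, div_pow]
    ring)
  have e := tsum_mul_tsum_eq_tsum_sum_antidiagonal_of_summable_norm
    (hasSum_riseCoeff (-1 / 2) hY).summable.norm
    (hasSum_riseCoeff (3 / 2) (x := U) (by rwa [abs_of_nonneg hU₀])).summable.norm
  rw [(hasSum_riseCoeff (-1 / 2) hY).tsum_eq,
    (hasSum_riseCoeff (3 / 2) (x := U) (by rwa [abs_of_nonneg hU₀])).tsum_eq] at e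
  have hval : ∑' q : ℕ × ℕ, sqrtCoeff W q.1 q.2 * (U ^ q.1 * V ^ q.2) =
      (1 - U)⁻¹ * √(1 + W / ((1 - U) * (1 - V))) := by
    rw [← hrow.tsum_eq]
    simp_rw [← Finset.sum_mul]
    rw [tsum_mul_right, ← e]
    have h1U : 0 < 1 - U := by linarith
    have h1X : 0 < 1 + X := by linarith
    have h2 : 0 ≤ 1 - U / (1 + X) := by linarith [le_abs_self (U / (1 + X))]
    rw [show -(-1 / 2 : ℝ) = 1 / 2 by norm_num, ← Real.sqrt_eq_rpow,
      show -(3 / 2 : ℝ) = -1 + -(1 / 2) by norm_num, Real.rpow_add h1U, Real.rpow_neg_one,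
      Real.rpow_neg h1U.le, ← Real.sqrt_eq_rpow,
      show 1 + W / ((1 - U) * (1 - V)) = (1 - U / (1 + X)) * (1 + X) / (1 - U) by
        rw [show W / ((1 - U) * (1 - V)) = X / (1 - U) by rw [hX, div_div, mul_comm]]
        field_simp
        ring,
      Real.sqrt_div (by positivity), Real.sqrt_mul h2]
    ring
  rw [← hval]
  exact hS.hasSum

/-! ### Termwise integration over the polar rectangle. -/

open MeasureTheory Set

/-- Dominated convergence: on a finite measure space a summable family of constants is an integrable
majorant. -/
theorem hasSum_integral_of_uniform_bound {α ι : Type*} [Countable ι] [MeasurableSpace α]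
    {μ : Measure α} [IsFiniteMeasure μ] {F : ι → α → ℝ} {f : α → ℝ} {b : ι → ℝ}
    (hF : ∀ i, AEStronglyMeasurable (F i) μ) (hb : Summable b)
    (hFb : ∀ i, ∀ᵐ x ∂μ, |F i x| ≤ b i) (hf : ∀ᵐ x ∂μ, HasSum (fun i => F i x) (f x)) :
    Integrable f μ ∧ HasSum (fun i => ∫ x, F i x ∂μ) (∫ x, f x ∂μ) := by
  have hsum := hasSum_integral_of_dominated_convergence (fun i _ => b i) hF hFb
    (Filter.Eventually.of_forall fun _ => hb) (integrable_const _) hf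
  refine ⟨Integrable.mono' (integrable_const (∑' i, b i)) ?_ ?_, hsum⟩
  · refine aestronglyMeasurable_of_tendsto_ae Filter.atTop
      (f := fun s : Finset ι => fun x => ∑ i ∈ s, F i x)
      (fun s => Finset.aestronglyMeasurable_fun_sum s fun i _ => hF i) ?_
    filter_upwards [hf] with x hx
    simpa [HasSum] using hx
  · filter_upwards [ae_all_iff.mpr hFb, hf] with x hx hfx
    rw [← hfx.tsum_eq]
    exact tsum_of_norm_bounded hb.hasSum hx

theorem poch_add_one_mul_factorial (k n : ℕ) : poch (k + 1) n * k.factorial = (k + n).factorial := by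
  rw [← poch_one (k + n), poch_add, poch_one, add_comm (1 : ℝ), mul_comm]

theorem integral_Ioc_pow {v : ℝ} (hv : 0 ≤ v) (n : ℕ) :
    ∫ ρ in Ioc 0 v, ρ ^ n = v ^ (n + 1) / (n + 1) := by
  rw [← intervalIntegral.integral_of_le hv, integral_pow]
  simp

/-- Wallis' formula on (0, π), counted twice because sin² has period π. -/
theorem integral_sin_sq_pow (m : ℕ) :
    ∫ φ in Ioo (-Real.pi) Real.pi, (Real.sin φ ^ 2) ^ m = 2 * Real.pi * riseCoeff (1 / 2) m := by
  have hper : Function.Periodic (fun φ => (Real.sin φ ^ 2) ^ m) Real.pi := fun φ => by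
    simp [Real.sin_add_pi]
  have h0 : ∫ φ in (0 : ℝ)..Real.pi, (Real.sin φ ^ 2) ^ m = Real.pi * riseCoeff (1 / 2) m := by
    simp_rw [← pow_mul]
    rw [integral_sin_pow_even]
    congr 1
    induction m with
    | zero => simp [riseCoeff_zero]
    | succ m ih =>
      rw [Finset.prod_range_succ, ih (fun φ => by simp [Real.sin_add_pi]), riseCoeff_succ]
      congr 1
      field_simp
      ring
  have h1 : ∫ φ in (-Real.pi)..0, (Real.sin φ ^ 2) ^ m = Real.pi * riseCoeff (1 / 2) m := by
    have := hper.intervalIntegral_add_eq (-Real.pi) 0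
    rw [neg_add_cancel, zero_add] at this
    rw [this, h0]
  rw [← integral_Ioc_eq_integral_Ioo, ← intervalIntegral.integral_of_le (by linarith [Real.pi_pos]),
    ← intervalIntegral.integral_add_adjacent_intervals (b := 0), h0, h1]
  · ring
  · exact (by fun_prop : Continuous fun φ => (Real.sin φ ^ 2) ^ m).intervalIntegrable _ _
  · exact (by fun_prop : Continuous fun φ => (Real.sin φ ^ 2) ^ m).intervalIntegrable _ _

/-- Lebesgue measure on the rectangle `0 < ρ ≤ v`, `-π < φ < π`. -/
noncomputable def polarRect (v : ℝ) : Measure (ℝ × ℝ) :=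
  (volume.restrict (Ioc 0 v)).prod (volume.restrict (Ioo (-Real.pi) Real.pi))

instance (v : ℝ) : IsFiniteMeasure (polarRect v) := by
  unfold polarRect
  infer_instance

theorem polarRect_eq (v : ℝ) :
    polarRect v = volume.restrict (Ioc 0 v ×ˢ Ioo (-Real.pi) Real.pi) := by
  rw [polarRect, Measure.prod_restrict, Measure.volume_eq_prod]

theorem ae_polarRect (v : ℝ) : ∀ᵐ p ∂polarRect v, 0 < p.1 ∧ p.1 ≤ v := by
  rw [polarRect_eq]
  filter_upwards [ae_restrict_mem (measurableSet_Ioc.prod measurableSet_Ioo)] with p hp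
  exact hp.1

theorem integral_polarRect_mul_sin (v : ℝ) (f : ℝ → ℝ) (u : ℝ) (m : ℕ) :
    ∫ p, f p.1 * (u * Real.sin p.2 ^ 2) ^ m ∂polarRect v =
      (∫ ρ in Ioc 0 v, f ρ) * (u ^ m * (2 * Real.pi * riseCoeff (1 / 2) m)) := by
  rw [polarRect, integral_prod_mul f (fun φ => (u * Real.sin φ ^ 2) ^ m)]
  simp_rw [mul_pow u]
  rw [integral_const_mul, integral_sin_sq_pow]

theorem mul_sin_sq_nonneg_and_le {u : ℝ} (hu₀ : 0 ≤ u) (φ : ℝ) :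
    0 ≤ u * Real.sin φ ^ 2 ∧ u * Real.sin φ ^ 2 ≤ u :=
  ⟨by positivity, mul_le_of_le_one_right hu₀ (Real.sin_sq_le_one φ)⟩

/-! ### Expansion and integration of the kernel. -/

/-- The part of the polar integrand that does not involve `(1 - ρ)⁻¹`. -/
noncomputable def coreKernel (κ u : ℝ) (p : ℝ × ℝ) : ℝ :=
  (1 - u * Real.sin p.2 ^ 2)⁻¹ * √(1 + κ * p.1 / (1 - u * Real.sin p.2 ^ 2))

/-- The surface element of the hemiellipsoid in elliptic polar coordinates, up to a constant. -/
noncomputable def polarKernel (κ u : ℝ) (p : ℝ × ℝ) : ℝ :=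
  (1 - u * Real.sin p.2 ^ 2)⁻¹ * √(1 + κ * p.1 / ((1 - u * Real.sin p.2 ^ 2) * (1 - p.1)))

/-- Summing over the power of U first leaves a binomial series at W/(1 - U) < 1. -/
theorem summable_coreKernel {U W : ℝ} (hU₀ : 0 ≤ U) (hW₀ : 0 ≤ W) (h : U + W < 1) :
    Summable fun q : ℕ × ℕ =>
      |riseCoeff (-1 / 2) q.2| * W ^ q.2 * riseCoeff (q.2 + 1) q.1 * U ^ q.1 := by
  have hU1 : 0 < 1 - U := by linarith
  have inner : ∀ n : ℕ, HasSum (fun m : ℕ =>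
      |riseCoeff (-1 / 2) n| * W ^ n * riseCoeff (n + 1) m * U ^ m)
      ((1 - U)⁻¹ * (|riseCoeff (-1 / 2) n| * (W / (1 - U)) ^ n)) := by
    intro n
    have h := (hasSum_riseCoeff_natCast_real (n + 1) (x := U)
      (by rw [abs_of_nonneg hU₀]; linarith)).mul_left (|riseCoeff (-1 / 2) n| * W ^ n)
    have e : (1 - U)⁻¹ * (|riseCoeff (-1 / 2) n| * (W / (1 - U)) ^ n) =
        |riseCoeff (-1 / 2) n| * W ^ n * ((1 - U) ^ (n + 1))⁻¹ := by
      rw [div_pow]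
      field_simp
      ring
    rw [e]
    refine h.congr_fun fun m => ?_
    push_cast
    ring
  refine Summable.prod_symm (f := fun q : ℕ × ℕ =>
    |riseCoeff (-1 / 2) q.1| * W ^ q.1 * riseCoeff (q.1 + 1) q.2 * U ^ q.2) ?_
  refine (summable_prod_of_nonneg fun q => ?_).mpr ⟨fun n => (inner n).summable, ?_⟩
  · have := riseCoeff_nonneg (by positivity : (0 : ℝ) ≤ q.1 + 1) q.2
    simp only [Pi.zero_apply]
    positivity
  · simp only [(inner _).tsum_eq]
    exact (summable_abs_riseCoeff _ (div_nonneg hW₀ hU1.le)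
      ((div_lt_one hU1).mpr (by linarith))).mul_left _

theorem hasSum_coreKernel {U W : ℝ} (hU₀ : 0 ≤ U) (hW₀ : 0 ≤ W) (h : U + W < 1) :
    HasSum (fun q : ℕ × ℕ =>
      riseCoeff (-1 / 2) q.2 * (-W) ^ q.2 * riseCoeff (q.2 + 1) q.1 * U ^ q.1)
      ((1 - U)⁻¹ * √(1 + W / (1 - U))) := by
  have hU1 : 0 < 1 - U := by linarith
  have hS : Summable fun q : ℕ × ℕ =>
      riseCoeff (-1 / 2) q.1 * (-W) ^ q.1 * riseCoeff (q.1 + 1) q.2 * U ^ q.2 := by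
    refine Summable.of_norm ((summable_coreKernel hU₀ hW₀ h).prod_symm.congr fun q => ?_)
    have := riseCoeff_nonneg (by positivity : (0 : ℝ) ≤ q.1 + 1) q.2
    simp [abs_of_nonneg hU₀, abs_of_nonneg hW₀, abs_of_nonneg this]
  have hrow := hS.hasSum.prod_fiberwise
    (g := fun n => (1 - U)⁻¹ * (riseCoeff (-1 / 2) n * (-W / (1 - U)) ^ n)) (fun n => by
      have h := (hasSum_riseCoeff_natCast_real (n + 1) (x := U)
        (by rw [abs_of_nonneg hU₀]; linarith)).mul_left (riseCoeff (-1 / 2) n * (-W) ^ n)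
      have e : (1 - U)⁻¹ * (riseCoeff (-1 / 2) n * (-W / (1 - U)) ^ n) =
          riseCoeff (-1 / 2) n * (-W) ^ n * ((1 - U) ^ (n + 1))⁻¹ := by
        rw [div_pow]
        field_simp
        ring
      rw [e]
      refine h.congr_fun fun m => ?_
      push_cast
      ring)
  have hW : |-W / (1 - U)| < 1 := by
    rw [abs_div, abs_neg, abs_of_nonneg hW₀, abs_of_pos hU1, div_lt_one hU1]
    linarith
  have hval := (hasSum_riseCoeff (-1 / 2) hW).mul_left (1 - U)⁻¹
  rw [show -(-1 / 2 : ℝ) = 1 / 2 by norm_num, ← Real.sqrt_eq_rpow,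
    show 1 - -W / (1 - U) = 1 + W / (1 - U) by ring] at hval
  rw [hval.unique hrow]
  exact (Equiv.prodComm ℕ ℕ).hasSum_iff.mpr hS.hasSum

theorem integrable_mul_sin_polarRect {v : ℝ} {f : ℝ → ℝ} (hf : IntegrableOn f (Ioc 0 v)) (u : ℝ)
    (m : ℕ) : Integrable (fun p => f p.1 * (u * Real.sin p.2 ^ 2) ^ m) (polarRect v) := by
  refine Integrable.mul_prod hf (g := fun φ => (u * Real.sin φ ^ 2) ^ m) ?_
  have hc : Continuous fun φ : ℝ => (u * Real.sin φ ^ 2) ^ m := by fun_prop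
  exact (hc.integrableOn_Icc (a := -Real.pi) (b := Real.pi)).mono_set Ioo_subset_Icc_self

theorem integrable_coreKernel_and_hasSum {κ u v : ℝ} (hκ : 0 ≤ κ) (hu : 0 ≤ u) (hv : 0 ≤ v)
    (h : u + κ * v < 1) :
    Integrable (coreKernel κ u) (polarRect v) ∧
    HasSum (fun q : ℕ × ℕ => riseCoeff (-1 / 2) q.2 * (-κ) ^ q.2 * riseCoeff (q.2 + 1) q.1 *
        (v ^ (q.2 + 1) / (q.2 + 1)) * (u ^ q.1 * (2 * Real.pi * riseCoeff (1 / 2) q.1)))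
      (∫ p, coreKernel κ u p ∂polarRect v) := by
  have hint : ∀ n : ℕ, IntegrableOn (fun ρ : ℝ => ρ ^ n) (Ioc 0 v) := fun n =>
    ((continuous_pow n).integrableOn_Icc (a := 0) (b := v)).mono_set Ioc_subset_Icc_self
  have key := hasSum_integral_of_uniform_bound (μ := polarRect v) (f := coreKernel κ u)
    (F := fun (q : ℕ × ℕ) p => riseCoeff (-1 / 2) q.2 * (-κ) ^ q.2 * riseCoeff (q.2 + 1) q.1 *
      p.1 ^ q.2 * (u * Real.sin p.2 ^ 2) ^ q.1)
    (fun q => (integrable_mul_sin_polarRect ((hint q.2).const_mul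
      (riseCoeff (-1 / 2) q.2 * (-κ) ^ q.2 * riseCoeff (q.2 + 1) q.1)) u
        q.1).aestronglyMeasurable)
    (summable_coreKernel hu (mul_nonneg hκ hv) h)
    (fun q => by
      filter_upwards [ae_polarRect v] with p hp
      obtain ⟨hU₀, hU₁⟩ := mul_sin_sq_nonneg_and_le hu p.2
      have hr := riseCoeff_nonneg (by positivity : (0 : ℝ) ≤ q.2 + 1) q.1
      rw [abs_mul, abs_mul, abs_mul, abs_mul, abs_pow, abs_neg, abs_of_nonneg hκ,
        abs_of_nonneg hr, abs_of_nonneg (pow_nonneg hp.1.le _), abs_of_nonneg (pow_nonneg hU₀ _),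
        mul_pow κ v]
      have e : |riseCoeff (-1 / 2) q.2| * (κ ^ q.2 * v ^ q.2) * riseCoeff (q.2 + 1) q.1 * u ^ q.1 =
        |riseCoeff (-1 / 2) q.2| * κ ^ q.2 * riseCoeff (q.2 + 1) q.1 * v ^ q.2 * u ^ q.1 := by ring
      rw [e]
      gcongr
      · exact hp.1.le
      · exact hp.2)
    (by
      filter_upwards [ae_polarRect v] with p hp
      obtain ⟨hU₀, hU₁⟩ := mul_sin_sq_nonneg_and_le hu p.2
      have hle : κ * p.1 ≤ κ * v := mul_le_mul_of_nonneg_left hp.2 hκ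
      refine (hasSum_coreKernel hU₀ (mul_nonneg hκ hp.1.le) (by linarith)).congr_fun fun q => ?_
      rw [← neg_mul, mul_pow (-κ)]
      ring)
  refine ⟨key.1, key.2.congr_fun fun q => ?_⟩
  rw [integral_polarRect_mul_sin v (fun ρ => riseCoeff (-1 / 2) q.2 * (-κ) ^ q.2 *
    riseCoeff (q.2 + 1) q.1 * ρ ^ q.2), integral_const_mul, integral_Ioc_pow hv]

theorem integrableOn_sqrtCoeff_and_hasSum {κ v : ℝ} (hκ : 0 ≤ κ) (hv : 0 ≤ v) (hκv : κ * v < 1)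
    (m j : ℕ) :
    IntegrableOn (fun ρ => sqrtCoeff (κ * ρ) m j * ρ ^ j) (Ioc 0 v) ∧
    HasSum (fun n : ℕ => riseCoeff (-1 / 2) n * (-κ) ^ n * riseCoeff (n + 1) m * riseCoeff n j *
        (v ^ (n + j + 1) / (n + j + 1)))
      (∫ ρ in Ioc 0 v, sqrtCoeff (κ * ρ) m j * ρ ^ j) := by
  have hmem : ∀ᵐ ρ ∂(volume.restrict (Ioc 0 v)), ρ ∈ Ioc 0 v := ae_restrict_mem measurableSet_Ioc
  have key := hasSum_integral_of_uniform_bound (μ := volume.restrict (Ioc 0 v))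
    (f := fun ρ => sqrtCoeff (κ * ρ) m j * ρ ^ j)
    (F := fun (n : ℕ) ρ => riseCoeff (-1 / 2) n * (-κ) ^ n * riseCoeff (n + 1) m * riseCoeff n j *
      ρ ^ (n + j))
    (fun n => (by fun_prop : Continuous fun ρ : ℝ => riseCoeff (-1 / 2) n * (-κ) ^ n *
      riseCoeff (n + 1) m * riseCoeff n j * ρ ^ (n + j)).aestronglyMeasurable)
    ((hasSum_sqrtCoeff (mul_nonneg hκ hv) hκv m j).summable.abs.mul_right (v ^ j))
    (fun n => by
      filter_upwards [hmem] with ρ hρ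
      rw [mul_comm κ v, ← mul_neg, mul_pow, pow_add]
      have e : riseCoeff (-1 / 2) n * (-κ) ^ n * riseCoeff (n + 1) m * riseCoeff n j *
          (ρ ^ n * ρ ^ j) = riseCoeff (-1 / 2) n * (ρ ^ n * (-κ) ^ n) * riseCoeff (n + 1) m *
          riseCoeff n j * ρ ^ j := by ring
      rw [e]
      simp only [abs_mul, abs_pow, abs_of_pos hρ.1, abs_of_nonneg hv]
      gcongr
      · exact pow_nonneg hρ.1.le j
      · exact hρ.1.le
      · exact hρ.2
      · exact hρ.1.le
      · exact hρ.2)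
    (by
      filter_upwards [hmem] with ρ hρ
      have hle : κ * ρ ≤ κ * v := mul_le_mul_of_nonneg_left hρ.2 hκ
      refine ((hasSum_sqrtCoeff (mul_nonneg hκ hρ.1.le) (by linarith) m j).mul_right
        (ρ ^ j)).congr_fun fun n => ?_
      rw [← neg_mul, mul_pow (-κ)]
      ring)
  refine ⟨key.1, key.2.congr_fun fun n => ?_⟩
  rw [integral_const_mul, integral_Ioc_pow hv]
  push_cast
  rfl

/-- The core kernel is the same double series at V = 0, so subtracting it removes exactly the column
j = 0. -/
theorem hasSum_polarKernel_sub_coreKernel {κ u v : ℝ} (hκ : 0 ≤ κ) (hu₀ : 0 ≤ u) (hu₁ : u < 1)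
    (hv : v < 1) (hκv : κ * v < 1) {p : ℝ × ℝ} (hp₀ : 0 < p.1) (hp₁ : p.1 ≤ v) :
    HasSum (fun q : ℕ × ℕ => sqrtCoeff (κ * p.1) q.1 (q.2 + 1) * p.1 ^ (q.2 + 1) *
      (u * Real.sin p.2 ^ 2) ^ q.1) (polarKernel κ u p - coreKernel κ u p) := by
  obtain ⟨hU₀, hU₁⟩ := mul_sin_sq_nonneg_and_le hu₀ p.2
  have hle : κ * p.1 ≤ κ * v := mul_le_mul_of_nonneg_left hp₁ hκ
  have hW₁ : κ * p.1 < 1 := by linarith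
  have h1 := hasSum_sqrtCoeff_double (mul_nonneg hκ hp₀.le) hW₁ hU₀ (hU₁.trans_lt hu₁) hp₀.le
    (hp₁.trans_lt hv)
  have h2 := hasSum_sqrtCoeff_double (mul_nonneg hκ hp₀.le) hW₁ hU₀ (hU₁.trans_lt hu₁) le_rfl
    zero_lt_one
  rw [sub_zero, mul_one] at h2
  have h3 := h1.sub h2
  have hinj : Function.Injective fun q : ℕ × ℕ => (q.1, q.2 + 1) := by
    rintro ⟨a, b⟩ ⟨c, d⟩ h
    simpa using h
  -- Reindex by j + 1; the terms off the range of this shift cancel.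
  rw [← hinj.hasSum_iff] at h3
  · refine h3.congr_fun fun q => ?_
    simp only [Function.comp_apply, zero_pow (Nat.succ_ne_zero _)]
    ring
  · rintro ⟨m, j⟩ hq
    cases j with
    | zero => simp
    | succ j => exact absurd ⟨(m, j), rfl⟩ hq

theorem integrable_polarKernel_sub_and_hasSum {κ u v : ℝ} (hκ : 0 ≤ κ) (hu₀ : 0 ≤ u)
    (hu₁ : u < 1) (hv₀ : 0 ≤ v) (hv₁ : v < 1) (hκv : κ * v < 1) :
    Integrable (fun p => polarKernel κ u p - coreKernel κ u p) (polarRect v) ∧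
    HasSum (fun q : ℕ × ℕ => (∫ ρ in Ioc 0 v, sqrtCoeff (κ * ρ) q.1 (q.2 + 1) * ρ ^ (q.2 + 1)) *
        (u ^ q.1 * (2 * Real.pi * riseCoeff (1 / 2) q.1)))
      (∫ p, (polarKernel κ u p - coreKernel κ u p) ∂polarRect v) := by
  obtain ⟨r, hvr, hr₁⟩ := exists_between hv₁
  have hr₀ : 0 < r := hv₀.trans_lt hvr
  have hinj : Function.Injective fun q : ℕ × ℕ => (q.1, q.2 + 1) := by
    rintro ⟨a, b⟩ ⟨c, d⟩ h
    simpa using h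
  have key := hasSum_integral_of_uniform_bound (μ := polarRect v)
    (f := fun p => polarKernel κ u p - coreKernel κ u p)
    (F := fun (q : ℕ × ℕ) p => sqrtCoeff (κ * p.1) q.1 (q.2 + 1) * p.1 ^ (q.2 + 1) *
      (u * Real.sin p.2 ^ 2) ^ q.1)
    (fun q => (integrable_mul_sin_polarRect
      (integrableOn_sqrtCoeff_and_hasSum hκ hv₀ hκv q.1 (q.2 + 1)).1 u q.1).aestronglyMeasurable)
    ((summable_majorant hu₀ hu₁ hv₀ hvr hr₁).comp_injective hinj)
    (fun q => by
      filter_upwards [ae_polarRect v] with p hp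
      obtain ⟨hU₀, hU₁⟩ := mul_sin_sq_nonneg_and_le hu₀ p.2
      have hle : κ * p.1 ≤ κ * v := mul_le_mul_of_nonneg_left hp.2 hκ
      have hb := abs_sqrtCoeff_le (mul_nonneg hκ hp.1.le) (by linarith) hr₀ hr₁ q.1 (q.2 + 1)
      rw [mul_assoc, mul_comm (p.1 ^ (q.2 + 1)), abs_mul, abs_mul,
        abs_of_nonneg (pow_nonneg hp.1.le _), abs_of_nonneg (pow_nonneg hU₀ _)]
      have h1 := pow_le_pow_left₀ hp.1.le hp.2 (q.2 + 1)
      have h2 := pow_le_pow_left₀ hU₀ hU₁ q.1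
      exact mul_le_mul hb (mul_le_mul h2 h1 (pow_nonneg hp.1.le _) (pow_nonneg hu₀ _))
        (mul_nonneg (pow_nonneg hU₀ _) (pow_nonneg hp.1.le _)) ((abs_nonneg _).trans hb))
    (by
      filter_upwards [ae_polarRect v] with p hp
      exact hasSum_polarKernel_sub_coreKernel hκ hu₀ hu₁ hv₁ hκv hp.1 hp.2)
  refine ⟨key.1, key.2.congr_fun fun q => ?_⟩
  rw [integral_polarRect_mul_sin v (fun ρ => sqrtCoeff (κ * ρ) q.1 (q.2 + 1) * ρ ^ (q.2 + 1))]

/-! ### Identification with the terms of F₂ and F⁽³⁾. -/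

theorem riseCoeff_natCast_add_one (n m : ℕ) :
    riseCoeff (n + 1) m = (n + m).factorial / (n.factorial * m.factorial) := by
  rw [riseCoeff, eq_div_iff (by positivity), ← poch_add_one_mul_factorial n m]
  field_simp

theorem poch_natCast_add_one (k n : ℕ) : poch (k + 1) n = (k + n).factorial / k.factorial := by
  rw [eq_div_iff (by positivity), poch_add_one_mul_factorial]

theorem appellF2Term_eq (u w : ℝ) (q : ℕ × ℕ) :
    appellF2Term 1 (1 / 2) (-1 / 2) 1 2 u w q =
      riseCoeff (-1 / 2) q.2 * riseCoeff (q.2 + 1) q.1 * riseCoeff (1 / 2) q.1 / (q.2 + 1) *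
        (u ^ q.1 * w ^ q.2) := by
  have h2 := poch_natCast_add_one 1 q.2
  norm_num at h2
  rw [appellF2Term, h2, riseCoeff_natCast_add_one, poch_one, poch_one, riseCoeff, riseCoeff,
    add_comm q.1, add_comm 1 q.2, Nat.factorial_succ]
  push_cast
  field_simp

theorem poch_neg_half_succ (p : ℕ) : poch (-1 / 2) (p + 1) = -1 / 2 * poch (1 / 2) p := by
  rw [add_comm, poch_add]
  congr 1
  · rw [poch_succ, poch_zero]
    norm_num
  · norm_num

theorem frustumParams_term_eq (x y z : ℝ) (m j p : ℕ) :
    srivastavaF3Term frustumParams x y z m j p =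
      -6 / (p + j + 3) * riseCoeff (-1 / 2) (p + 1) * riseCoeff (p + 2) m *
        riseCoeff (p + 1) (j + 1) * riseCoeff (1 / 2) m * (x ^ m * y ^ j * z ^ p) := by
  have h2 : ∀ N : ℕ, poch 2 N = (N + 1).factorial := fun N => by
    have := poch_natCast_add_one 1 N
    norm_num at this
    rw [this, add_comm]
  have h3 : ∀ N : ℕ, poch 3 N = (N + 2).factorial / 2 := fun N => by
    have := poch_natCast_add_one 2 N
    norm_num at this
    rw [this, add_comm]
  have h4 : ∀ N : ℕ, poch 4 N = (N + 3).factorial / 6 := fun N => by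
    have := poch_natCast_add_one 3 N
    norm_num [Nat.factorial] at this
    rw [this, add_comm]
  have hp2 := riseCoeff_natCast_add_one (p + 1) m
  push_cast at hp2
  rw [show (p : ℝ) + 1 + 1 = p + 2 by ring] at hp2
  simp only [srivastavaF3Term, SrivastavaParams.coeff, frustumParams, pochList, List.map_nil,
    List.map_cons, List.prod_nil, List.prod_cons, h2, h3, h4, hp2, riseCoeff_natCast_add_one,
    poch_one]
  rw [riseCoeff, riseCoeff, poch_neg_half_succ, show p + 1 + m = m + p + 1 by ring,
    show p + (j + 1) = j + p + 1 by ring, show j + p + 3 = j + p + 2 + 1 by ring,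
    Nat.factorial_succ (j + p + 2), Nat.factorial_succ p, Nat.factorial_succ j]
  push_cast
  field_simp
  ring

theorem hasSum_appellF2Term {κ u v : ℝ} (hκ : 0 ≤ κ) (hu : 0 ≤ u) (hv : 0 < v)
    (h : u + κ * v < 1) :
    HasSum (appellF2Term 1 (1 / 2) (-1 / 2) 1 2 u (-(κ * v)))
      ((∫ p, coreKernel κ u p ∂polarRect v) / (2 * Real.pi * v)) := by
  have hs := (integrable_coreKernel_and_hasSum hκ hu hv.le h).2.div_const (2 * Real.pi * v)
  refine hs.congr_fun fun q => ?_
  have := Real.pi_pos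
  rw [appellF2Term_eq, ← neg_mul, mul_pow (-κ)]
  field_simp
  ring

theorem hasSum_frustumParams_inner {κ u v : ℝ} (hκ : 0 < κ) (hv : 0 < v) (hκv : κ * v < 1)
    (m j : ℕ) :
    HasSum (fun p => srivastavaF3Term frustumParams u v (-(κ * v)) m j p)
      ((∫ ρ in Ioc 0 v, sqrtCoeff (κ * ρ) m (j + 1) * ρ ^ (j + 1)) *
        (u ^ m * (2 * Real.pi * riseCoeff (1 / 2) m)) / (Real.pi * κ * v ^ 3 / 3)) := by
  have hs := (integrableOn_sqrtCoeff_and_hasSum hκ.le hv.le hκv m (j + 1)).2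
  -- The term n = 0 vanishes because (0)_{j+1} = 0, so the index p of F⁽³⁾ is n - 1.
  rw [← hasSum_nat_add_iff' 1] at hs
  simp only [Finset.range_one, Finset.sum_singleton, Nat.cast_zero, riseCoeff_zero_succ,
    mul_zero, zero_mul, sub_zero] at hs
  have hs2 := (hs.mul_right (u ^ m * (2 * Real.pi * riseCoeff (1 / 2) m))).div_const
    (Real.pi * κ * v ^ 3 / 3)
  refine hs2.congr_fun fun p => ?_
  have := Real.pi_pos
  rw [frustumParams_term_eq, ← neg_mul, mul_pow (-κ)]
  push_cast
  rw [show (p : ℝ) + 1 + 1 = p + 2 by ring, show (p : ℝ) + 1 + (j + 1) + 1 = p + j + 3 by ring,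
    eq_div_iff (by positivity)]
  have h3 : (p : ℝ) + j + 3 ≠ 0 := by positivity
  field_simp
  ring

theorem hasSum_frustumParams_outer {κ u v : ℝ} (hκ : 0 < κ) (hu₀ : 0 ≤ u) (hu₁ : u < 1)
    (hv₀ : 0 < v) (hv₁ : v < 1) (hκv : κ * v < 1) :
    HasSum (fun q : ℕ × ℕ => ∑' p, srivastavaF3Term frustumParams u v (-(κ * v)) q.1 q.2 p)
      ((∫ p, (polarKernel κ u p - coreKernel κ u p) ∂polarRect v) / (Real.pi * κ * v ^ 3 / 3)) := by
  have hs := (integrable_polarKernel_sub_and_hasSum hκ.le hu₀ hu₁ hv₀.le hv₁ hκv).2.div_const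
    (Real.pi * κ * v ^ 3 / 3)
  exact hs.congr_fun fun q => (hasSum_frustumParams_inner hκ hv₀ hκv q.1 q.2).tsum_eq

theorem integral_polarKernel {κ u v : ℝ} (hκ : 0 < κ) (hu₀ : 0 ≤ u) (hv₀ : 0 < v) (hv₁ : v < 1)
    (h : u + κ * v < 1) :
    Integrable (polarKernel κ u) (polarRect v) ∧
    ∫ p, polarKernel κ u p ∂polarRect v =
      2 * Real.pi * v * appellF2 1 (1 / 2) (-1 / 2) 1 2 u (-(κ * v)) +
        Real.pi * κ * v ^ 3 / 3 * srivastavaF3 frustumParams u v (-(κ * v)) := by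
  have hκv : κ * v < 1 := by linarith
  have hu₁ : u < 1 := by nlinarith
  have hcore := (integrable_coreKernel_and_hasSum hκ.le hu₀ hv₀.le h).1
  have hsub := (integrable_polarKernel_sub_and_hasSum hκ.le hu₀ hu₁ hv₀.le hv₁ hκv).1
  have hadd : (fun p => polarKernel κ u p) =
      fun p => coreKernel κ u p + (polarKernel κ u p - coreKernel κ u p) := by
    funext p
    ring
  have := Real.pi_pos
  refine ⟨?_, ?_⟩
  · change Integrable (fun p => polarKernel κ u p) (polarRect v)
    rw [hadd]
    exact hcore.add hsub
  · rw [hadd, integral_add hcore hsub, appellF2, srivastavaF3,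
      (hasSum_appellF2Term hκ.le hu₀ hv₀ h).tsum_eq,
      (hasSum_frustumParams_outer hκ hu₀ hu₁ hv₀ hv₁ hκv).tsum_eq]
    field_simp

/-- Up to a constant, the terms are dominated by those of Σ_p w^p ((1 - u)(1 - v))^(-(p+2)), with
both negative powers expanded; this is a geometric series of ratio w/((1 - u)(1 - v)). -/
theorem summable_frustumParams_triple {u v w : ℝ} (hu₀ : 0 ≤ u) (hu₁ : u < 1) (hv₀ : 0 < v)
    (hv₁ : v < 1) (hw : 0 ≤ w) (h : w < (1 - u) * (1 - v)) :
    Summable fun q : ℕ × ℕ × ℕ => srivastavaF3Term frustumParams u v (-w) q.1 q.2.1 q.2.2 := by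
  have hU : 0 < 1 - u := by linarith
  have hV : 0 < 1 - v := by linarith
  have hu' : |u| < 1 := by rwa [abs_of_nonneg hu₀]
  have hv' : |v| < 1 := by rwa [abs_of_pos hv₀]
  have hmaj : Summable fun q : ℕ × ℕ × ℕ => w ^ q.1 *
      ((riseCoeff (q.1 + 2 : ℕ) q.2.1 * u ^ q.2.1) *
        (riseCoeff (q.1 + 2 : ℕ) q.2.2 * v ^ q.2.2)) := by
    have hrow : ∀ p : ℕ, HasSum (fun q : ℕ × ℕ => w ^ p *
        ((riseCoeff (p + 2 : ℕ) q.1 * u ^ q.1) * (riseCoeff (p + 2 : ℕ) q.2 * v ^ q.2)))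
        (((1 - u) ^ 2)⁻¹ * ((1 - v) ^ 2)⁻¹ * (w / ((1 - u) * (1 - v))) ^ p) := by
      intro p
      have h1 := hasSum_riseCoeff_natCast_real (p + 2) hu'
      have h2 := hasSum_riseCoeff_natCast_real (p + 2) hv'
      have h3 := (h1.mul h2 (h1.summable.mul_of_nonneg h2.summable
        (fun m => mul_nonneg (riseCoeff_nonneg (Nat.cast_nonneg _) _) (pow_nonneg hu₀ _))
        (fun m => mul_nonneg (riseCoeff_nonneg (Nat.cast_nonneg _) _)
          (pow_nonneg hv₀.le _)))).mul_left (w ^ p)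
      have e : ((1 - u) ^ 2)⁻¹ * ((1 - v) ^ 2)⁻¹ * (w / ((1 - u) * (1 - v))) ^ p =
          w ^ p * (((1 - u) ^ (p + 2))⁻¹ * ((1 - v) ^ (p + 2))⁻¹) := by
        rw [div_pow, mul_pow, pow_add, pow_add]
        field_simp
      rw [e]
      exact h3
    refine (summable_prod_of_nonneg fun q => ?_).mpr ⟨fun p => (hrow p).summable, ?_⟩
    · have h1 := riseCoeff_nonneg (Nat.cast_nonneg (α := ℝ) (q.1 + 2)) q.2.1
      have h2 := riseCoeff_nonneg (Nat.cast_nonneg (α := ℝ) (q.1 + 2)) q.2.2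
      simp only [Pi.zero_apply]
      positivity
    · simp only [(hrow _).tsum_eq]
      exact (summable_geometric_of_lt_one (by positivity)
        ((div_lt_one (by positivity)).mpr h)).mul_left _
  have hinj : Function.Injective fun q : ℕ × ℕ × ℕ => (q.2.2, q.1, q.2.1 + 1) := by
    rintro ⟨a, b, c⟩ ⟨a', b', c'⟩ h
    simp only [Prod.mk.injEq, add_left_inj] at h
    simp [h]
  -- The majorant is read at j + 1, so it carries v^(j+1) against v^j: hence the division by v. The
  -- 6 bounds the rational prefactor.
  refine Summable.of_norm_bounded (((hmaj.comp_injective hinj)).mul_left (6 / v)) fun q => ?_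
  obtain ⟨m, j, p⟩ := q
  simp only [Function.comp_apply]
  rw [frustumParams_term_eq, Real.norm_eq_abs]
  have a1 := abs_riseCoeff_le_one (α := -1 / 2) (by norm_num) (by norm_num) (p + 1)
  have a2 := abs_riseCoeff_le_one (α := 1 / 2) (by norm_num) (by norm_num) m
  have a3 : (0 : ℝ) ≤ riseCoeff (p + 2) m := riseCoeff_nonneg (by positivity) _
  have a4 : (0 : ℝ) ≤ riseCoeff (p + 1) (j + 1) := riseCoeff_nonneg (by positivity) _
  have a5 : riseCoeff ((p : ℝ) + 1) (j + 1) ≤ riseCoeff (p + 2) (j + 1) :=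
    riseCoeff_mono (by positivity) (by linarith) _
  have a6 : |-6 / ((p : ℝ) + j + 3)| ≤ 6 := by
    rw [abs_div, abs_of_pos (by positivity : (0 : ℝ) < p + j + 3), div_le_iff₀ (by positivity)]
    have h1 : (0 : ℝ) ≤ p := p.cast_nonneg
    have h2 : (0 : ℝ) ≤ j := j.cast_nonneg
    norm_num
    linarith
  simp only [abs_mul, abs_pow, abs_neg, abs_of_nonneg a3, abs_of_nonneg a4, abs_of_nonneg hu₀,
    abs_of_pos hv₀, abs_of_nonneg hw]
  calc |-6 / ((p : ℝ) + j + 3)| * |riseCoeff (-1 / 2) (p + 1)| * riseCoeff (p + 2) m *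
        riseCoeff (p + 1) (j + 1) * |riseCoeff (1 / 2) m| * (u ^ m * v ^ j * w ^ p)
      ≤ 6 * 1 * riseCoeff (p + 2) m * riseCoeff (p + 2) (j + 1) * 1 *
        (u ^ m * v ^ j * w ^ p) := by
        have a7 := a4.trans a5
        gcongr
    _ = _ := by
      push_cast
      rw [pow_succ v]
      field_simp

/-! ### The hemiellipsoid over the elliptic annulus. -/

theorem frustumShadow_eq_annulus {a b c h H β γ : ℝ} (hc : 0 < c) (hh : 0 < h) (hH : 0 < H)
    (hβH : β ^ 2 = 1 - H ^ 2 / c ^ 2) (hγh : γ ^ 2 = 1 - h ^ 2 / c ^ 2) :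
    frustumShadow a b c h H =
      {q : ℝ × ℝ | β ^ 2 ≤ q.1 ^ 2 / a ^ 2 + q.2 ^ 2 / b ^ 2 ∧
        q.1 ^ 2 / a ^ 2 + q.2 ^ 2 / b ^ 2 ≤ γ ^ 2} := by
  ext ⟨x, y⟩
  simp only [frustumShadow, hemiellipsoid, mem_ofPred_eq]
  have e1 : h ≤ c * √(1 - x ^ 2 / a ^ 2 - y ^ 2 / b ^ 2) ↔
      h ^ 2 / c ^ 2 ≤ 1 - x ^ 2 / a ^ 2 - y ^ 2 / b ^ 2 := by
    rw [← div_le_iff₀' hc, Real.le_sqrt' (by positivity), div_pow]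
  have e2 : c * √(1 - x ^ 2 / a ^ 2 - y ^ 2 / b ^ 2) ≤ H ↔
      1 - x ^ 2 / a ^ 2 - y ^ 2 / b ^ 2 ≤ H ^ 2 / c ^ 2 := by
    rw [← le_div_iff₀' hc, Real.sqrt_le_left (by positivity), div_pow]
  rw [e1, e2, hβH, hγh]
  constructor <;> rintro ⟨h1, h2⟩ <;> constructor <;> linarith

theorem hasDerivAt_hemiellipsoid_fst {a b c x y : ℝ}
    (hs : 0 < 1 - x ^ 2 / a ^ 2 - y ^ 2 / b ^ 2) :
    HasDerivAt (fun x => hemiellipsoid a b c x y)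
      (-(c * x / (a ^ 2 * √(1 - x ^ 2 / a ^ 2 - y ^ 2 / b ^ 2)))) x := by
  have h1 : HasDerivAt (fun x : ℝ => 1 - x ^ 2 / a ^ 2 - y ^ 2 / b ^ 2) (-(2 * x / a ^ 2)) x := by
    have := (((hasDerivAt_pow 2 x).div_const (a ^ 2)).const_sub 1).sub_const (y ^ 2 / b ^ 2)
    simpa using this
  have h2 := (h1.sqrt hs.ne').const_mul c
  refine h2.congr_deriv ?_
  rw [neg_div, mul_neg, div_div]
  congr 1
  rw [show 2 * x / (a ^ 2 * (2 * √(1 - x ^ 2 / a ^ 2 - y ^ 2 / b ^ 2))) =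
    2 * x / (2 * (a ^ 2 * √(1 - x ^ 2 / a ^ 2 - y ^ 2 / b ^ 2))) by ring_nf,
    mul_div_mul_left _ _ two_ne_zero, mul_div_assoc]

theorem hemiellipsoid_swap (a b c x y : ℝ) : hemiellipsoid a b c x y = hemiellipsoid b a c y x := by
  rw [hemiellipsoid, hemiellipsoid, sub_right_comm]

theorem hasDerivAt_hemiellipsoid_snd {a b c x y : ℝ}
    (hs : 0 < 1 - x ^ 2 / a ^ 2 - y ^ 2 / b ^ 2) :
    HasDerivAt (fun y => hemiellipsoid a b c x y)
      (-(c * y / (b ^ 2 * √(1 - x ^ 2 / a ^ 2 - y ^ 2 / b ^ 2)))) y := by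
  rw [sub_right_comm] at hs ⊢
  simp_rw [hemiellipsoid_swap a b]
  exact hasDerivAt_hemiellipsoid_fst hs

theorem areaElement_hemiellipsoid {a b c : ℝ} (ha : a ≠ 0) (hb : b ≠ 0) {q : ℝ × ℝ}
    (hs : 0 < 1 - q.1 ^ 2 / a ^ 2 - q.2 ^ 2 / b ^ 2) :
    areaElement (hemiellipsoid a b c) q =
      √(1 + c ^ 2 / a ^ 2 * (q.1 ^ 2 / a ^ 2 + a ^ 2 * q.2 ^ 2 / b ^ 4) /
        (1 - q.1 ^ 2 / a ^ 2 - q.2 ^ 2 / b ^ 2)) := by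
  rw [areaElement, (hasDerivAt_hemiellipsoid_fst hs).deriv, (hasDerivAt_hemiellipsoid_snd hs).deriv,
    neg_sq, neg_sq, div_pow, div_pow, mul_pow _ (√_), mul_pow _ (√_), Real.sq_sqrt hs.le]
  congr 1
  generalize 1 - q.1 ^ 2 / a ^ 2 - q.2 ^ 2 / b ^ 2 = s at hs
  field_simp
  ring

theorem isCompact_annulus {a b : ℝ} (ha : 0 < a) (hb : 0 < b) (s t : ℝ) :
    IsCompact {q : ℝ × ℝ | s ≤ q.1 ^ 2 / a ^ 2 + q.2 ^ 2 / b ^ 2 ∧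
      q.1 ^ 2 / a ^ 2 + q.2 ^ 2 / b ^ 2 ≤ t} := by
  have hcont : Continuous fun q : ℝ × ℝ => q.1 ^ 2 / a ^ 2 + q.2 ^ 2 / b ^ 2 := by fun_prop
  refine (isCompact_Icc.prod isCompact_Icc :
    IsCompact (Icc (-(a * √t)) (a * √t) ×ˢ Icc (-(b * √t)) (b * √t))).of_isClosed_subset
    ((isClosed_le continuous_const hcont).inter (isClosed_le hcont continuous_const)) ?_
  rintro ⟨x, y⟩ ⟨-, h⟩
  simp only at h
  have hx : 0 ≤ x ^ 2 / a ^ 2 := by positivity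
  have hy : 0 ≤ y ^ 2 / b ^ 2 := by positivity
  have key : ∀ z d : ℝ, 0 < d → z ^ 2 / d ^ 2 ≤ t → z ∈ Icc (-(d * √t)) (d * √t) := by
    intro z d hd hz
    rw [mem_Icc, ← abs_le, ← div_le_iff₀' hd]
    refine Real.le_sqrt_of_sq_le ?_
    rwa [div_pow, sq_abs]
  exact ⟨key x a ha (by linarith), key y b hb (by linarith)⟩

/-- The annulus is compact and stays inside the open ellipse because t < 1, so the explicit formula
is continuous on it. -/
theorem integrableOn_areaElement {a b c : ℝ} (ha : 0 < a) (hb : 0 < b) (s : ℝ) {t : ℝ}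
    (ht : t < 1) : IntegrableOn (areaElement (hemiellipsoid a b c))
      {q : ℝ × ℝ | s ≤ q.1 ^ 2 / a ^ 2 + q.2 ^ 2 / b ^ 2 ∧
        q.1 ^ 2 / a ^ 2 + q.2 ^ 2 / b ^ 2 ≤ t} := by
  have hK := isCompact_annulus ha hb s t
  refine IntegrableOn.congr_fun (f := fun q : ℝ × ℝ =>
      √(1 + c ^ 2 / a ^ 2 * (q.1 ^ 2 / a ^ 2 + a ^ 2 * q.2 ^ 2 / b ^ 4) /
        (1 - q.1 ^ 2 / a ^ 2 - q.2 ^ 2 / b ^ 2))) (ContinuousOn.integrableOn_compact hK ?_)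
    (fun q hq => (areaElement_hemiellipsoid ha.ne' hb.ne' (by linarith [hq.2])).symm) hK.measurableSet
  refine ContinuousOn.sqrt (continuousOn_const.add (ContinuousOn.div (by fun_prop) (by fun_prop) ?_))
  intro q hq
  have := hq.2
  exact (by linarith : (0 : ℝ) < 1 - q.1 ^ 2 / a ^ 2 - q.2 ^ 2 / b ^ 2).ne'

/-! ### Change to elliptic polar coordinates. -/

theorem integral_comp_scale {a d : ℝ} (ha : a ≠ 0) (hd : d ≠ 0) (f : ℝ × ℝ → ℝ) :
    ∫ p, f p = |a * d| * ∫ p : ℝ × ℝ, f (a * p.1, d * p.2) := by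
  have hmap : Measure.map (Prod.map (a * ·) (d * ·)) (volume : Measure (ℝ × ℝ)) =
      ENNReal.ofReal |(a * d)⁻¹| • volume := by
    rw [Measure.volume_eq_prod, ← Measure.map_prod_map _ _ (by fun_prop) (by fun_prop),
      Real.map_volume_mul_left ha, Real.map_volume_mul_left hd, Measure.prod_smul_left,
      Measure.prod_smul_right, smul_smul, ← ENNReal.ofReal_mul (abs_nonneg _), ← abs_mul, mul_inv]
  have hemb : MeasurableEmbedding (Prod.map (a * ·) (d * ·) : ℝ × ℝ → ℝ × ℝ) :=
    (measurableEmbedding_mulLeft₀ ha).prodMap (measurableEmbedding_mulLeft₀ hd)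
  have h := hemb.integral_map (μ := (volume : Measure (ℝ × ℝ))) f
  rw [hmap, integral_smul_measure, ENNReal.toReal_ofReal (abs_nonneg _), smul_eq_mul] at h
  simp only [Prod.map] at h
  rw [← h, ← mul_assoc, ← abs_mul, mul_inv_cancel₀ (mul_ne_zero ha hd), abs_one, one_mul]

/-- The points of the polar coordinate domain with `β² ≤ R² (1 - u sin² φ) ≤ γ²`. -/
def polarAnnulus (u s t : ℝ) : Set (ℝ × ℝ) :=
  {p | 0 < p.1 ∧ p.2 ∈ Ioo (-Real.pi) Real.pi ∧
    s ≤ p.1 ^ 2 * (1 - u * Real.sin p.2 ^ 2) ∧ p.1 ^ 2 * (1 - u * Real.sin p.2 ^ 2) ≤ t}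

/-- The area element of the hemiellipsoid in polar coordinates. -/
noncomputable def polarArea (κ u : ℝ) (p : ℝ × ℝ) : ℝ :=
  p.1 * √(1 + κ * p.1 ^ 2 / (1 - p.1 ^ 2 * (1 - u * Real.sin p.2 ^ 2)))

theorem measurableSet_polarAnnulus (u s t : ℝ) : MeasurableSet (polarAnnulus u s t) := by
  have hcont : Continuous fun p : ℝ × ℝ => p.1 ^ 2 * (1 - u * Real.sin p.2 ^ 2) := by fun_prop
  exact (measurableSet_lt measurable_const measurable_fst).inter
    ((measurable_snd measurableSet_Ioo).inter
      ((measurableSet_le measurable_const hcont.measurable).inter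
        (measurableSet_le hcont.measurable measurable_const)))

theorem integrableOn_polarArea {κ u s t : ℝ} (hu₀ : 0 ≤ u) (hu₁ : u < 1) (ht : t < 1) :
    IntegrableOn (polarArea κ u) (polarAnnulus u s t) := by
  have hcont : Continuous fun p : ℝ × ℝ => p.1 ^ 2 * (1 - u * Real.sin p.2 ^ 2) := by fun_prop
  have hK : IsCompact ((Icc 0 √(t / (1 - u)) ×ˢ Icc (-Real.pi) Real.pi) ∩
      {p : ℝ × ℝ | p.1 ^ 2 * (1 - u * Real.sin p.2 ^ 2) ≤ t}) :=
    (isCompact_Icc.prod isCompact_Icc).inter_right (isClosed_le hcont continuous_const)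
  refine (ContinuousOn.integrableOn_compact hK ?_).mono_set ?_
  · refine continuousOn_fst.mul (ContinuousOn.sqrt (continuousOn_const.add
      (ContinuousOn.div (by fun_prop) (by fun_prop) fun p hp => ?_)))
    have := hp.2
    simp only [mem_ofPred_eq] at this
    linarith
  · rintro p ⟨h1, h2, -, h3⟩
    refine ⟨⟨⟨h1.le, Real.le_sqrt_of_sq_le ?_⟩, Ioo_subset_Icc_self h2⟩, h3⟩
    rw [le_div_iff₀ (by linarith)]
    have := (mul_sin_sq_nonneg_and_le hu₀ p.2).2
    nlinarith [sq_nonneg p.1]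

/-- Substitute ρ = R²q at a fixed angle, with dρ = 2Rq dR; the endpoint ρ = s is a null set. -/
theorem integral_radial {κ q s t : ℝ} (hq : 0 < q) (hs : 0 < s) :
    ∫ R in {R : ℝ | 0 < R ∧ s ≤ R ^ 2 * q ∧ R ^ 2 * q ≤ t},
        R * √(1 + κ * R ^ 2 / (1 - R ^ 2 * q)) =
      ∫ ρ in Ioc s t, 1 / 2 * (q⁻¹ * √(1 + κ * ρ / (q * (1 - ρ)))) := by
  have himg : (fun R : ℝ => R ^ 2 * q) '' {R : ℝ | 0 < R ∧ s ≤ R ^ 2 * q ∧ R ^ 2 * q ≤ t} =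
      Icc s t := by
    ext ρ
    constructor
    · rintro ⟨R, ⟨-, h1, h2⟩, rfl⟩
      exact ⟨h1, h2⟩
    · rintro ⟨h1, h2⟩
      have hρ : 0 < ρ := hs.trans_le h1
      have e : √(ρ / q) ^ 2 * q = ρ := by
        rw [Real.sq_sqrt (by positivity)]
        field_simp
      exact ⟨√(ρ / q), ⟨by positivity, by rwa [e], by rwa [e]⟩, e⟩
  have hcont : Continuous fun R : ℝ => R ^ 2 * q := by fun_prop
  have hmeas : MeasurableSet {R : ℝ | 0 < R ∧ s ≤ R ^ 2 * q ∧ R ^ 2 * q ≤ t} :=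
    (measurableSet_lt measurable_const measurable_id).inter
      ((measurableSet_le measurable_const hcont.measurable).inter
        (measurableSet_le hcont.measurable measurable_const))
  rw [← integral_Icc_eq_integral_Ioc, ← himg, integral_image_eq_integral_abs_deriv_smul hmeas
    (f' := fun R => 2 * R * q)]
  · refine setIntegral_congr_fun hmeas fun R hR => ?_
    have hR0 : 0 < R := hR.1
    simp only [smul_eq_mul]
    rw [abs_of_pos (by positivity),
      show κ * (R ^ 2 * q) / (q * (1 - R ^ 2 * q)) = κ * R ^ 2 / (1 - R ^ 2 * q) by
        rw [mul_comm q, ← mul_assoc, mul_div_mul_right _ _ hq.ne']]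
    field_simp
  · intro R _
    have := ((hasDerivAt_pow 2 R).mul_const q).hasDerivWithinAt
      (s := {R : ℝ | 0 < R ∧ s ≤ R ^ 2 * q ∧ R ^ 2 * q ≤ t})
    simpa using this
  · intro R hR R' hR' h
    have h2 : R ^ 2 = R' ^ 2 := mul_right_cancel₀ hq.ne' h
    exact (pow_left_inj₀ hR.1.le hR'.1.le two_ne_zero).mp h2

/-- Fubini with the angle outside: each radial slice is the substitution ρ = R²q, which straightens
the angle-dependent bounds on R. -/
theorem integral_polarArea {κ u s t : ℝ} (hu₀ : 0 ≤ u) (hu₁ : u < 1) (hs : 0 < s) (ht : t < 1)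
    (hK : IntegrableOn (polarKernel κ u) (Ioc s t ×ˢ Ioo (-Real.pi) Real.pi)) :
    ∫ p in polarAnnulus u s t, polarArea κ u p =
      1 / 2 * ∫ p in Ioc s t ×ˢ Ioo (-Real.pi) Real.pi, polarKernel κ u p := by
  have hm1 := measurableSet_polarAnnulus u s t
  have hm2 : MeasurableSet (Ioc s t ×ˢ Ioo (-Real.pi) Real.pi) :=
    measurableSet_Ioc.prod measurableSet_Ioo
  have hK' : IntegrableOn (fun p => 1 / 2 * polarKernel κ u p)
      (Ioc s t ×ˢ Ioo (-Real.pi) Real.pi) := hK.const_mul _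
  rw [← integral_const_mul, ← integral_indicator hm1, ← integral_indicator hm2,
    Measure.volume_eq_prod,
    integral_prod_symm _ ((integrable_indicator_iff hm1).mpr (integrableOn_polarArea hu₀ hu₁ ht)),
    integral_prod_symm _ ((integrable_indicator_iff hm2).mpr hK')]
  congr 1
  funext φ
  by_cases hφ : φ ∈ Ioo (-Real.pi) Real.pi
  · have hq : 0 < 1 - u * Real.sin φ ^ 2 := by linarith [(mul_sin_sq_nonneg_and_le hu₀ φ).2]
    have hcont : Continuous fun R : ℝ => R ^ 2 * (1 - u * Real.sin φ ^ 2) := by fun_prop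
    have hmeas : MeasurableSet {R : ℝ | 0 < R ∧ s ≤ R ^ 2 * (1 - u * Real.sin φ ^ 2) ∧
        R ^ 2 * (1 - u * Real.sin φ ^ 2) ≤ t} :=
      (measurableSet_lt measurable_const measurable_id).inter
        ((measurableSet_le measurable_const hcont.measurable).inter
          (measurableSet_le hcont.measurable measurable_const))
    have h := integral_radial (κ := κ) (t := t) hq hs
    rw [← integral_indicator hmeas, ← integral_indicator measurableSet_Ioc] at h
    have e1 : ∀ R, (polarAnnulus u s t).indicator (polarArea κ u) (R, φ) =
        {R : ℝ | 0 < R ∧ s ≤ R ^ 2 * (1 - u * Real.sin φ ^ 2) ∧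
          R ^ 2 * (1 - u * Real.sin φ ^ 2) ≤ t}.indicator
          (fun R => R * √(1 + κ * R ^ 2 / (1 - R ^ 2 * (1 - u * Real.sin φ ^ 2)))) R := fun R => by
      simp only [indicator, polarAnnulus, mem_ofPred_eq, hφ, true_and, polarArea]
    have e2 : ∀ ρ, (Ioc s t ×ˢ Ioo (-Real.pi) Real.pi).indicator
        (fun p => 1 / 2 * polarKernel κ u p) (ρ, φ) = (Ioc s t).indicator (fun ρ => 1 / 2 *
          ((1 - u * Real.sin φ ^ 2)⁻¹ * √(1 + κ * ρ / ((1 - u * Real.sin φ ^ 2) * (1 - ρ))))) ρ :=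
      fun ρ => by simp only [indicator, mem_prod, hφ, and_true, polarKernel]
    simp only [e1, e2]
    exact h
  · have e1 : ∀ R, (polarAnnulus u s t).indicator (polarArea κ u) (R, φ) = 0 := fun R =>
      indicator_of_notMem (fun h => hφ h.2.1) _
    have e2 : ∀ ρ, (Ioc s t ×ˢ Ioo (-Real.pi) Real.pi).indicator
        (fun p => 1 / 2 * polarKernel κ u p) (ρ, φ) = 0 := fun ρ =>
      indicator_of_notMem (fun h => hφ h.2) _
    simp only [e1, e2, integral_zero]

theorem integral_areaElement_annulus {a b c s t : ℝ} (ha : 0 < a) (hb : 0 < b) (ht : t < 1) :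
    ∫ q in {q : ℝ × ℝ | s ≤ q.1 ^ 2 / a ^ 2 + q.2 ^ 2 / b ^ 2 ∧
        q.1 ^ 2 / a ^ 2 + q.2 ^ 2 / b ^ 2 ≤ t}, areaElement (hemiellipsoid a b c) q =
      b ^ 2 * ∫ p in polarAnnulus (1 - b ^ 2 / a ^ 2) s t,
        polarArea (c ^ 2 / a ^ 2) (1 - b ^ 2 / a ^ 2) p := by
  have hD := (isCompact_annulus ha hb s t).measurableSet
  -- Scaling y by b²/a rather than b makes x²/a² + a²y²/b⁴ equal to R², so the angle enters the area
  -- element only through q.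
  rw [← integral_indicator hD, integral_comp_scale ha.ne' (div_pos (pow_pos hb 2) ha).ne',
    show a * (b ^ 2 / a) = b ^ 2 by field_simp, abs_of_pos (by positivity),
    ← integral_comp_polarCoord_symm,
    ← integral_indicator (measurableSet_polarAnnulus _ _ _),
    ← integral_indicator polarCoord.open_target.measurableSet]
  congr 2
  funext p
  obtain ⟨R, φ⟩ := p
  have hr : (a * (R * Real.cos φ)) ^ 2 / a ^ 2 + (b ^ 2 / a * (R * Real.sin φ)) ^ 2 / b ^ 2 =
      R ^ 2 * (1 - (1 - b ^ 2 / a ^ 2) * Real.sin φ ^ 2) := by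
    rw [mul_pow, mul_pow R, Real.cos_sq']
    field_simp
    ring
  by_cases hp : (R, φ) ∈ polarCoord.target
  · rw [indicator_of_mem hp]
    obtain ⟨hR, hφ⟩ : 0 < R ∧ φ ∈ Ioo (-Real.pi) Real.pi := hp
    by_cases hA : (R, φ) ∈ polarAnnulus (1 - b ^ 2 / a ^ 2) s t
    · have hmem : (a * (R * Real.cos φ), b ^ 2 / a * (R * Real.sin φ)) ∈
          {q : ℝ × ℝ | s ≤ q.1 ^ 2 / a ^ 2 + q.2 ^ 2 / b ^ 2 ∧
            q.1 ^ 2 / a ^ 2 + q.2 ^ 2 / b ^ 2 ≤ t} := by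
        simp only [mem_ofPred_eq, hr]
        exact hA.2.2
      rw [indicator_of_mem hA]
      simp only [polarCoord_symm_apply, smul_eq_mul]
      rw [indicator_of_mem hmem, areaElement_hemiellipsoid ha.ne' hb.ne', polarArea]
      · simp only [sub_sub, hr]
        congr 5
        rw [mul_pow, mul_pow (b ^ 2 / a), mul_pow R, mul_pow R, Real.cos_sq']
        field_simp
        ring
      · simp only [sub_sub, hr]
        linarith [hA.2.2.2]
    · have hmem : (a * (R * Real.cos φ), b ^ 2 / a * (R * Real.sin φ)) ∉
          {q : ℝ × ℝ | s ≤ q.1 ^ 2 / a ^ 2 + q.2 ^ 2 / b ^ 2 ∧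
            q.1 ^ 2 / a ^ 2 + q.2 ^ 2 / b ^ 2 ≤ t} := by
        simp only [mem_ofPred_eq, hr]
        exact fun h => hA ⟨hR, hφ, h⟩
      rw [indicator_of_notMem hA]
      simp only [polarCoord_symm_apply, smul_eq_mul]
      rw [indicator_of_notMem hmem, mul_zero]
  · rw [indicator_of_notMem hp, indicator_of_notMem fun h => hp ⟨h.1, h.2.1⟩]

/-! ### Assembly. -/

theorem frustum_parameter_bounds {a b c v : ℝ} (hc : 0 < c) (hcb : c < b) (hba : b < a)
    (hv : v < 1) :
    0 < c ^ 2 / a ^ 2 ∧ 0 ≤ 1 - b ^ 2 / a ^ 2 ∧ 1 - b ^ 2 / a ^ 2 < 1 ∧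
      1 - b ^ 2 / a ^ 2 + c ^ 2 / a ^ 2 * v < 1 ∧ c ^ 2 / a ^ 2 * v < 1 := by
  have hb : 0 < b := hc.trans hcb
  have ha : 0 < a := hb.trans hba
  have h1 : c ^ 2 / a ^ 2 < b ^ 2 / a ^ 2 := by gcongr
  have h2 : b ^ 2 / a ^ 2 < 1 := by
    rw [div_lt_one (by positivity)]
    gcongr
  have h3 : 0 < c ^ 2 / a ^ 2 := by positivity
  have h4 : c ^ 2 / a ^ 2 * v < c ^ 2 / a ^ 2 := mul_lt_of_lt_one_right h3 hv
  refine ⟨h3, ?_, ?_, ?_, ?_⟩ <;> linarith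

theorem integrable_polarKernel_polarRect {a b c t : ℝ} (hc : 0 < c) (hcb : c < b) (hba : b < a)
    (ht : 0 < t) (ht₁ : t ^ 2 < 1) :
    Integrable (polarKernel (c ^ 2 / a ^ 2) (1 - b ^ 2 / a ^ 2)) (polarRect (t ^ 2)) := by
  obtain ⟨hκ, hu₀, -, hκu, -⟩ := frustum_parameter_bounds hc hcb hba ht₁
  exact (integral_polarKernel hκ hu₀ (pow_pos ht 2) ht₁ hκu).1

theorem frustumPhi_eq_integral {a b c t : ℝ} (hc : 0 < c) (hcb : c < b) (hba : b < a) (ht : 0 < t)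
    (ht₁ : t ^ 2 < 1) :
    frustumPhi a b c t = b ^ 2 * (1 / 2 * ∫ p,
      polarKernel (c ^ 2 / a ^ 2) (1 - b ^ 2 / a ^ 2) p ∂polarRect (t ^ 2)) := by
  obtain ⟨hκ, hu₀, -, hκu, -⟩ := frustum_parameter_bounds hc hcb hba ht₁
  rw [(integral_polarKernel hκ hu₀ (pow_pos ht 2) ht₁ hκu).2, frustumPhi,
    mul_div_right_comm (c ^ 2)]
  have ha : a ≠ 0 := (hc.trans (hcb.trans hba)).ne'
  field_simp
  ring

theorem theorem4 (a b c h H β γ : ℝ) (hc : 0 < c) (hcb : c < b) (hba : b < a)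
    (hh : 0 < h) (hhH : h < H) (hHc : H < c)
    (hβ : 0 < β) (hβH : β ^ 2 = 1 - H ^ 2 / c ^ 2)
    (hγ : 0 < γ) (hγh : γ ^ 2 = 1 - h ^ 2 / c ^ 2) :
    -- the projection of the frustum is the elliptic annulus
    frustumShadow a b c h H =
      {q : ℝ × ℝ | β ^ 2 ≤ q.1 ^ 2 / a ^ 2 + q.2 ^ 2 / b ^ 2 ∧
        q.1 ^ 2 / a ^ 2 + q.2 ^ 2 / b ^ 2 ≤ γ ^ 2} ∧
    -- all partial derivatives in the area element exist, and the area element is integrable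
    (∀ q ∈ frustumShadow a b c h H,
      DifferentiableAt ℝ (fun x => hemiellipsoid a b c x q.2) q.1 ∧
      DifferentiableAt ℝ (fun y => hemiellipsoid a b c q.1 y) q.2) ∧
    MeasureTheory.IntegrableOn (areaElement (hemiellipsoid a b c)) (frustumShadow a b c h H) ∧
    -- the series converge at both radii
    (∀ t : ℝ, t = β ∨ t = γ →
      Summable (appellF2Term 1 (1 / 2) (-1 / 2) 1 2
        (1 - b ^ 2 / a ^ 2) (-(c ^ 2 * t ^ 2 / a ^ 2))) ∧
      (∀ m n : ℕ, Summable (fun p : ℕ => srivastavaF3Term frustumParams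
        (1 - b ^ 2 / a ^ 2) (t ^ 2) (-(c ^ 2 * t ^ 2 / a ^ 2)) m n p)) ∧
      Summable (fun q : ℕ × ℕ => ∑' p : ℕ, srivastavaF3Term frustumParams
        (1 - b ^ 2 / a ^ 2) (t ^ 2) (-(c ^ 2 * t ^ 2 / a ^ 2)) q.1 q.2 p) ∧
      -- in this range also as an unordered triple series
      (c ^ 2 * t ^ 2 < b ^ 2 * (1 - t ^ 2) →
        Summable (fun q : ℕ × ℕ × ℕ => srivastavaF3Term frustumParams
          (1 - b ^ 2 / a ^ 2) (t ^ 2) (-(c ^ 2 * t ^ 2 / a ^ 2)) q.1 q.2.1 q.2.2))) ∧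
    -- the surface area
    ∫ q in frustumShadow a b c h H, areaElement (hemiellipsoid a b c) q =
      frustumPhi a b c γ - frustumPhi a b c β := by
  have hb : 0 < b := hc.trans hcb
  have ha : 0 < a := hb.trans hba
  have hH : 0 < H := hh.trans hhH
  have hγ₁ : γ ^ 2 < 1 := by
    rw [hγh]
    have : 0 < h ^ 2 / c ^ 2 := by positivity
    linarith
  have hβγ : β ^ 2 ≤ γ ^ 2 := by
    rw [hγh, hβH]
    have : h ^ 2 / c ^ 2 ≤ H ^ 2 / c ^ 2 := by gcongr
    linarith
  have hset := frustumShadow_eq_annulus (a := a) (b := b) hc hh hH hβH hγh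
  refine ⟨hset, fun q hq => ?_, ?_, fun t ht => ?_, ?_⟩
  · rw [hset] at hq
    have hs : 0 < 1 - q.1 ^ 2 / a ^ 2 - q.2 ^ 2 / b ^ 2 := by linarith [hq.2]
    exact ⟨(hasDerivAt_hemiellipsoid_fst hs).differentiableAt,
      (hasDerivAt_hemiellipsoid_snd hs).differentiableAt⟩
  · rw [hset]
    exact integrableOn_areaElement ha hb _ hγ₁
  · have ht₀ : 0 < t := by rcases ht with rfl | rfl <;> assumption
    have ht₁ : t ^ 2 < 1 := by
      rcases ht with rfl | rfl
      · exact hβγ.trans_lt hγ₁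
      · exact hγ₁
    obtain ⟨hκ, hu₀, hu₁, hκu, hκv⟩ := frustum_parameter_bounds hc hcb hba ht₁
    rw [mul_div_right_comm (c ^ 2)]
    refine ⟨(hasSum_appellF2Term hκ.le hu₀ (pow_pos ht₀ 2) hκu).summable,
      fun m n => (hasSum_frustumParams_inner hκ (pow_pos ht₀ 2) hκv m n).summable,
      (hasSum_frustumParams_outer hκ hu₀ hu₁ (pow_pos ht₀ 2) ht₁ hκv).summable, fun h => ?_⟩
    refine summable_frustumParams_triple hu₀ hu₁ (pow_pos ht₀ 2) ht₁ (by positivity) ?_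
    -- Here 1 - u = b²/a², so the criterion w < (1 - u)(1 - v) is the assumed inequality divided by
    -- a².
    rw [sub_sub_cancel, div_mul_eq_mul_div, div_mul_eq_mul_div]
    gcongr
  · have hK := integrable_polarKernel_polarRect hc hcb hba hγ hγ₁
    rw [polarRect_eq] at hK
    have hunion : Ioc 0 (γ ^ 2) ×ˢ Ioo (-Real.pi) Real.pi =
        Ioc 0 (β ^ 2) ×ˢ Ioo (-Real.pi) Real.pi ∪ Ioc (β ^ 2) (γ ^ 2) ×ˢ Ioo (-Real.pi) Real.pi := by
      rw [← union_prod, Ioc_union_Ioc_eq_Ioc (sq_nonneg β) hβγ]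
    have hdisj : Disjoint (Ioc 0 (β ^ 2) ×ˢ Ioo (-Real.pi) Real.pi)
        (Ioc (β ^ 2) (γ ^ 2) ×ˢ Ioo (-Real.pi) Real.pi) :=
      Disjoint.set_prod_left (Ioc_disjoint_Ioc_of_le le_rfl) _ _
    have hK₁ : IntegrableOn (polarKernel (c ^ 2 / a ^ 2) (1 - b ^ 2 / a ^ 2))
        (Ioc 0 (β ^ 2) ×ˢ Ioo (-Real.pi) Real.pi) :=
      IntegrableOn.mono_set hK (hunion ▸ subset_union_left)
    have hK₂ : IntegrableOn (polarKernel (c ^ 2 / a ^ 2) (1 - b ^ 2 / a ^ 2))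
        (Ioc (β ^ 2) (γ ^ 2) ×ˢ Ioo (-Real.pi) Real.pi) :=
      IntegrableOn.mono_set hK (hunion ▸ subset_union_right)
    obtain ⟨hκ, hu₀, hu₁, -⟩ := frustum_parameter_bounds hc hcb hba hγ₁
    rw [hset, integral_areaElement_annulus ha hb hγ₁,
      integral_polarArea hu₀ hu₁ (pow_pos hβ 2) hγ₁ hK₂,
      frustumPhi_eq_integral hc hcb hba hγ hγ₁,
      frustumPhi_eq_integral hc hcb hba hβ (hβγ.trans_lt hγ₁), polarRect_eq, polarRect_eq, hunion,
      setIntegral_union hdisj (measurableSet_Ioc.prod measurableSet_Ioo) hK₁ hK₂]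
    ring
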